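/- **Setting.** Let $V=\mathfrak h_{\mathbb R}^*$ carry a finite reduced crystallographic root system with roots $\alpha$, coroots $\alpha^\vee$, weight lattice $P=\{\lambda\in V : \langle\lambda,\alpha^\vee\rangle\in\mathbb Z \text{ for all roots } \alpha\}$, and fix a base of simple roots, $\alpha_i$ being one of them, with reflection $s_i$. For maps $p\colon[0,\ell]\to V$, $q\colon[0,\ell']\to V$ with $p(0)=q(0)=0$, let $\mathrm{wt}(p)=p(\ell)$; let $p\otimes q\colon[0,\ell+\ell']\to V$ be the concatenation ($p(t)$ for $t\le \ell$, $p(\ell)+q(t-\ell)$ for $t\ge\ell$); let $p^*(t)=p(\ell-t)-p(\ell)$ be the reverse; and for $r\in\mathbb R_{\ge0}$ let $rp\colon[0,r\ell]\to V$, $(rp)(t)=r\,p(t/r)$ be the $r$-stretch ($0p$ is the path of length $0$). Let $p_\lambda\colon[0,1]\to V$, $p_\lambda(t)=t\lambda$. Let $B_{\mathrm{univ}}$ be the set of maps generated by the $p_\lambda$, $\lambda\in P$, under concatenation, reversing and $r$-stretching, $r\in\mathbb R_{\ge 0}$, and let $B_{\mathbb Q}\subseteq B_{\mathrm{univ}}$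 be the subset obtained when only rational $r\ge0$ are used. **Rank one.** For $h\colon[0,\ell]\to\mathbb R$ continuous with $h(0)=0$ and minimum $m$ put $d^+(h)=h(\ell)-m$ and $d^-(h)=-m$. If $d^+(h)<1$ put $\tilde f h=0$, otherwise $(\tilde f h)(t)=h(t)-2\min\{1,\min_{s\ge t}h(s)-m\}$. If $d^-(h)<1$ put $\tilde e h=0$, otherwise $(\tilde e h)(t)=h(t)+2\bigl(1-\min\{1,\min_{s\le t}h(s)-m\}\bigr)$. Here $0$ is an extra symbol, not a path; all operations send it to $0$. **Root operators.** With $p_{\alpha}(t)=\langle p(t),\alpha^\vee\rangle$ put $d_i^\pm(p)=d^\pm(p_{\alpha_i})$, $\tilde e_ip=p+\tfrac12(\tilde e p_{\alpha_i}-p_{\alpha_i})\alpha_i$ and $\tilde f_ip=p-\tfrac12(p_{\alpha_i}-\tilde fp_{\alpha_i})\alpha_i$, read as $0$ when $\tilde ep_{\alpha_i}$, respectively $\tilde fp_{\alpha_i}$, is $0$. An operator $g\colon B\to B\cup\{0\}$ on a set $B$ of maps has *closed graph* if $p_n\to p$, $gp_n=x_n\neq0$, $x_n\to x$ (lengths converge,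 maps extended by their end value converge uniformly; $p_n,x_n,p,x\in B$) imply $gp=x$. **Theorem.** (0) The rank one operators are those of the pairing procedure. View a word in $+1,-1,0$ as the path $b_1\otimes\cdots\otimes b_k$, the letter $x$ being the path $t\mapsto tx$ on $[0,1]$; ignore $0$s and successively pair adjacent unpaired $(+1,-1)$ pairs. Then $d^+$ (resp. $d^-$) is the number of unpaired $+1$s (resp. $-1$s), $\tilde f$ changes the leftmost unpaired $+1$ to $-1$ (and gives $0$ if there is none), and $\tilde e$ changes the rightmost unpaired $-1$ to $+1$ (and gives $0$ if there is none). On the set $T_{\mathbb R}$ of maps generated by the paths $p_1,p_{-1},p_0$ in $\mathbb R$ under concatenation, reversing and real stretching, $\tilde f^r(rh)=r(\tilde fh)$ and $\tilde e^r(rh)=r(\tilde eh)$ for integers $r>0$, and $\tilde e,\tilde f$ have closed graph. (1) $\tilde e_i$ and $\tilde f_i$ are operators $B_{\mathrm{univ}}\to B_{\mathrm{univ}}\cup\{0\}$ with the following properties, for all $p,q\in B_{\mathrm{univ}}$. (a) If $\tilde f_ip\ne0$ then $\tilde e_i\tilde f_ip=p$; if $\tilde e_ip\neq0$ then $\tilde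 f_i\tilde e_ip=p$. (b) If $\lambda\in P$ and $\langle\lambda,\alpha_i^\vee\rangle\in\mathbb Z_{>0}$ then $\tilde f_i^{\langle\lambda,\alpha_i^\vee\rangle}p_\lambda=p_{s_i\lambda}$. (c) If $d_i^+(p)$ and $d_i^-(q)$ are integers, then $\tilde f_i(p\otimes q)=\tilde f_ip\otimes q$ if $d_i^+(p)>d_i^-(q)$ and $=p\otimes\tilde f_iq$ if $d_i^+(p)\le d_i^-(q)$; $\tilde e_i(p\otimes q)=\tilde e_ip\otimes q$ if $d_i^+(p)\ge d_i^-(q)$ and $=p\otimes\tilde e_iq$ if $d_i^+(p)<d_i^-(q)$. (d) For $r\in\mathbb Z_{\ge0}$, $\tilde f_i^r(rp)=r(\tilde f_ip)$ if $r>0$ or $\tilde f_ip\ne 0$, and $\tilde e_i^r(rp)=r(\tilde e_ip)$ if $r>0$ or $\tilde e_ip\neq0$. (e) $\tilde f_i(p^*)=(\tilde e_ip)^*$ and $\tilde e_i(p^*)=(\tilde f_ip)^*$. (f) If $\tilde f_ip\ne0$ then $\mathrm{wt}(\tilde f_ip)=\mathrm{wt}(p)-\alpha_i$; if $\tilde e_ip\ne0$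 then $\mathrm{wt}(\tilde e_ip)=\mathrm{wt}(p)+\alpha_i$. Moreover the formula in (c) for $\tilde f_i$ holds for all $p,q\in B_{\mathrm{univ}}$ with $d_i^+(p)-d_i^-(q)\notin(0,1)$, the formula for $\tilde e_i$ for all $p,q$ with $d_i^-(q)-d_i^+(p)\notin(0,1)$, and $\tilde e_i$, $\tilde f_i$ have closed graph. (2) Uniqueness. If $e,f\colon B_{\mathrm{univ}}\to B_{\mathrm{univ}}\cup\{0\}$ are any operators with properties (a)–(f) (with $e,f$ in place of $\tilde e_i,\tilde f_i$), then $e=\tilde e_i$ and $f=\tilde f_i$ on $B_{\mathbb Q}$. If in addition $e$ and $f$ have closed graph, then $e=\tilde e_i$ and $f=\tilde f_i$ on all of $B_{\mathrm{univ}}$. -/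

import Mathlib

open scoped NNReal

noncomputable section

/-! ### Maps `p : [0, ℓ] → V` -/

/-- A map `p : [0, ℓ] → V` with `p 0 = 0`, where `ℓ ≥ 0`.  It is recorded as a function on the
whole real line that is constant on each side of `[0, ℓ]`, so that two such maps are equal exactly
when their lengths agree and they agree on `[0, ℓ]`. -/
@[ext]
structure PathMap (V : Type*) [AddCommGroup V] where
  len : ℝ
  toFun : ℝ → V
  len_nonneg : 0 ≤ len
  eq_zero_of_le : ∀ t, t ≤ 0 → toFun t = 0
  eq_end_of_ge : ∀ t, len ≤ t → toFun t = toFun len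

namespace PathMap

variable {V : Type*} [AddCommGroup V]

/-- The map `[0, ℓ] → V` which is the restriction of `g`, for a function `g` with `g 0 = 0`. -/
def ofFun (ℓ : ℝ) (hℓ : 0 ≤ ℓ) (g : ℝ → V) (hg : g 0 = 0) : PathMap V where
  len := ℓ
  toFun t := g (max 0 (min t ℓ))
  len_nonneg := hℓ
  eq_zero_of_le t ht := by
    rw [min_eq_left (ht.trans hℓ), max_eq_left ht, hg]
  eq_end_of_ge t ht := by
    rw [min_eq_right ht, min_self]

/-- The weight of a map is its endpoint. -/
def wt (p : PathMap V) : V := p.toFun p.len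

/-- The concatenation `p ⊗ q`. -/
def concat (p q : PathMap V) : PathMap V :=
  ofFun (p.len + q.len) (add_nonneg p.len_nonneg q.len_nonneg)
    (fun t => if t ≤ p.len then p.toFun t else p.toFun p.len + q.toFun (t - p.len))
    (by simp only [if_pos p.len_nonneg, p.eq_zero_of_le 0 le_rfl])

/-- The reverse `p*`, with `p*(t) = p(ℓ - t) - p(ℓ)`. -/
def reverse (p : PathMap V) : PathMap V :=
  ofFun p.len p.len_nonneg (fun t => p.toFun (p.len - t) - p.toFun p.len) (by simp)

variable [Module ℝ V]

/-- The straight line path `p_μ : [0, 1] → V`, `t ↦ t μ`. -/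
def line (μ : V) : PathMap V :=
  ofFun 1 zero_le_one (fun t => t • μ) (zero_smul ℝ μ)

/-- The `r`-stretch `r p : [0, r ℓ] → V`, `t ↦ r p(t / r)`; for `r = 0` it is the map of length
zero. -/
def stretch (r : ℝ≥0) (p : PathMap V) : PathMap V :=
  ofFun (r * p.len) (mul_nonneg r.coe_nonneg p.len_nonneg) (fun t => (r : ℝ) • p.toFun (t / r))
    (by simp [p.eq_zero_of_le 0 le_rfl])

/-- The set of maps generated by the straight line paths `p_μ`, `μ ∈ Λ`, under concatenation,
reversing and `r`-stretching with `r ∈ S`. -/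
inductive Generated (Λ : Set V) (S : Set ℝ≥0) : PathMap V → Prop
  | line (μ : V) (hμ : μ ∈ Λ) : Generated Λ S (line μ)
  | concat (p q : PathMap V) : Generated Λ S p → Generated Λ S q → Generated Λ S (p.concat q)
  | reverse (p : PathMap V) : Generated Λ S p → Generated Λ S p.reverse
  | stretch (r : ℝ≥0) (hr : r ∈ S) (p : PathMap V) :
      Generated Λ S p → Generated Λ S (p.stretch r)

/-- Convergence of a sequence of maps: the lengths converge and the maps converge uniformly.
(Uniform convergence is tested on linear functionals; in finite dimension this is uniform
convergence in any norm.) -/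
def Converges (p : ℕ → PathMap V) (q : PathMap V) : Prop :=
  Filter.Tendsto (fun n => (p n).len) Filter.atTop (nhds q.len) ∧
    ∀ φ : V →ₗ[ℝ] ℝ,
      TendstoUniformly (fun n t => φ ((p n).toFun t)) (fun t => φ (q.toFun t)) Filter.atTop

/-- An operator `B → B ∪ {0}` has closed graph: if `p_n → p` and `g p_n → x`, all these maps being
nonzero elements of `B`, then `g p = x`. -/
def HasClosedGraph (B : Set (PathMap V)) (g : PathMap V → Option (PathMap V)) : Prop :=
  ∀ (p x : ℕ → PathMap V) (p₀ x₀ : PathMap V),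
    (∀ n, p n ∈ B) → (∀ n, x n ∈ B) → p₀ ∈ B → x₀ ∈ B →
    (∀ n, g (p n) = some (x n)) → Converges p p₀ → Converges x x₀ → g p₀ = some x₀

/-- The `n`-th power of an operator with values in `X ∪ {0}` (`none` is `0`, and `0 ↦ 0`). -/
def power {X : Type*} (g : X → Option X) : ℕ → X → Option X
  | 0, x => some x
  | n + 1, x => (power g n x).bind g

/-! ### The rank one operators

For `h : [0, ℓ] → ℝ` with minimum `m`, the part of the path where the future minimum
`t ↦ min_{s ≥ t} h(s)` strictly increases is the part made of the "unpaired `+1`s", and the part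
where the past minimum `t ↦ min_{s ≤ t} h(s)` strictly decreases is made of the "unpaired `-1`s". -/

/-- The minimum of `h` on `[a, c]`. -/
def minOn (h : PathMap ℝ) (a c : ℝ) : ℝ := sInf (h.toFun '' Set.Icc a c)

/-- `d⁺(h)`, the amount of unpaired `+1`s: the height of the endpoint above the minimum. -/
def dPlus (h : PathMap ℝ) : ℝ := h.toFun h.len - h.minOn 0 h.len

/-- `d⁻(h)`, the amount of unpaired `-1`s: the height of the initial point above the minimum. -/
def dMinus (h : PathMap ℝ) : ℝ := h.toFun 0 - h.minOn 0 h.len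

open Classical in
/-- The rank one operator `f̃`: the leftmost unit of unpaired `+1`s is reflected;
`f̃ h = 0` if there is less than one unit. -/
def rankOneF (h : PathMap ℝ) : Option (PathMap ℝ) :=
  if 1 ≤ h.dPlus then
    some (ofFun h.len h.len_nonneg
      (fun t => h.toFun t - 2 * min 1 (h.minOn t h.len - h.minOn 0 h.len))
      (by simp [h.eq_zero_of_le 0 le_rfl]))
  else none

open Classical in
/-- The rank one operator `ẽ`: the rightmost unit of unpaired `-1`s is reflected;
`ẽ h = 0` if there is less than one unit. -/
def rankOneE (h : PathMap ℝ) : Option (PathMap ℝ) :=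
  if hd : 1 ≤ h.dMinus then
    some (ofFun h.len h.len_nonneg
      (fun t => h.toFun t + 2 * (1 - min 1 (h.minOn 0 t - h.minOn 0 h.len)))
      (by
        have h0 : h.minOn 0 0 = h.toFun 0 := by simp [minOn]
        have h1 : 1 ≤ h.toFun 0 - h.minOn 0 h.len := hd
        rw [h0, min_eq_left h1, h.eq_zero_of_le 0 le_rfl]; ring))
  else none

end PathMap

/-! ### Words in `+1`, `-1`, `0` and the pairing procedure -/

namespace SignWord

/-- The number of unpaired `-1`s after adjacent (`+1`, `-1`) pairs have successively been paired:
a `+1` in front of a word is paired with the leftmost unpaired `-1` of that word, if there is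
one. -/
def unpairedNeg : List SignType → ℕ
  | [] => 0
  | SignType.pos :: w => unpairedNeg w - 1
  | SignType.neg :: w => unpairedNeg w + 1
  | SignType.zero :: w => unpairedNeg w

/-- The number of unpaired `+1`s after pairing. -/
def unpairedPos : List SignType → ℕ
  | [] => 0
  | SignType.pos :: w => if unpairedNeg w = 0 then unpairedPos w + 1 else unpairedPos w
  | SignType.neg :: w => unpairedPos w
  | SignType.zero :: w => unpairedPos w

/-- `f̃` on words: change the leftmost unpaired `+1` to `-1` (`none` if there is no unpaired
`+1`). -/
def opF : List SignType → Option (List SignType)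
  | [] => none
  | SignType.pos :: w =>
      if unpairedNeg w = 0 then some (SignType.neg :: w) else (opF w).map (SignType.pos :: ·)
  | SignType.neg :: w => (opF w).map (SignType.neg :: ·)
  | SignType.zero :: w => (opF w).map (SignType.zero :: ·)

/-- `ẽ` on words: change the rightmost unpaired `-1` to `+1` (`none` if there is no unpaired
`-1`). -/
def opE : List SignType → Option (List SignType)
  | [] => none
  | SignType.pos :: w => if unpairedNeg w ≤ 1 then none else (opE w).map (SignType.pos :: ·)
  | SignType.neg :: w =>
      if unpairedNeg w = 0 then some (SignType.pos :: w) else (opE w).map (SignType.neg :: ·)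
  | SignType.zero :: w => (opE w).map (SignType.zero :: ·)

/-- The word `b₁ ⊗ ⋯ ⊗ b_k` viewed as a map `[0, k] → ℝ`; the empty word is the map of
length zero. -/
def toPath : List SignType → PathMap ℝ
  | [] => PathMap.ofFun 0 le_rfl (fun _ => 0) rfl
  | x :: w => (PathMap.line (x : ℝ)).concat (toPath w)

end SignWord

/-- The rank one paths: generated by the straight line paths `p_1`, `p_{-1}`, `p_0` under
concatenation, reversing and stretching. -/
def rankOnePaths : Set (PathMap ℝ) :=
  {h | PathMap.Generated ({1, -1, 0} : Set ℝ) Set.univ h}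

open PathMap in
/-- The operators `ẽ, f̃` and the functions `d^±` on maps `[0, ℓ] → ℝ` extend those that the
pairing procedure defines on words, they satisfy `f̃^r (r h) = r (f̃ h)` and `ẽ^r (r h) = r (ẽ h)`
(which fixes them on rational stretches) and they have closed graph (which fixes them on the
completion). -/
def ExtendPairing (d₁ d₂ : PathMap ℝ → ℝ) (e f : PathMap ℝ → Option (PathMap ℝ)) : Prop :=
  (∀ w : List SignType,
    d₁ (SignWord.toPath w) = SignWord.unpairedPos w ∧
    d₂ (SignWord.toPath w) = SignWord.unpairedNeg w ∧
    f (SignWord.toPath w) = (SignWord.opF w).map SignWord.toPath ∧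
    e (SignWord.toPath w) = (SignWord.opE w).map SignWord.toPath) ∧
  (∀ h ∈ rankOnePaths, ∀ r : ℕ, 0 < r →
    power f r (h.stretch r) = (f h).map (stretch r) ∧
    power e r (h.stretch r) = (e h).map (stretch r)) ∧
  HasClosedGraph rankOnePaths e ∧ HasClosedGraph rankOnePaths f

/-! ### Paths and root operators for a root system -/

namespace RootPaths

open PathMap

variable {ι V N : Type*} [AddCommGroup V] [Module ℝ V] [AddCommGroup N] [Module ℝ N]
  (R : RootPairing ι ℝ V N)

/-- The weight lattice `P = {μ | ⟨μ, α^∨⟩ ∈ ℤ for all roots α}`. -/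
def weightLattice : Set V := {μ | ∀ j, ∃ n : ℤ, R.toLinearMap μ (R.coroot j) = n}

/-- `B_univ`: the maps generated by the straight line paths `p_μ`, `μ ∈ P`, under concatenation,
reversing and stretching. -/
def BUniv : Set (PathMap V) := {p | Generated (weightLattice R) Set.univ p}

/-- The paths for which only stretching by rational numbers is used. -/
def BRat : Set (PathMap V) :=
  {p | Generated (weightLattice R) (Set.range fun r : ℚ≥0 => (r : ℝ≥0)) p}

/-- The projection `p_α(t) = ⟨p(t), α^∨⟩`, where `α` is the `i`-th root. -/
def proj (i : ι) (p : PathMap V) : PathMap ℝ :=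
  ofFun p.len p.len_nonneg (fun t => R.toLinearMap (p.toFun t) (R.coroot i))
    (by simp [p.eq_zero_of_le 0 le_rfl])

/-- `d_α^+(p) = d⁺(p_α)`. -/
def dP (i : ι) (p : PathMap V) : ℝ := (proj R i p).dPlus

/-- `d_α^-(p) = d⁻(p_α)`. -/
def dM (i : ι) (p : PathMap V) : ℝ := (proj R i p).dMinus

/-- The root operator `f̃_α p = p - ½ (p_α - f̃ p_α) α` (and `0` if `f̃ p_α = 0`). -/
def rootF (i : ι) (p : PathMap V) : Option (PathMap V) :=
  (rankOneF (proj R i p)).map fun x =>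
    ofFun p.len p.len_nonneg
      (fun t => p.toFun t - ((1 / 2 : ℝ) * ((proj R i p).toFun t - x.toFun t)) • R.root i)
      (by simp [PathMap.eq_zero_of_le])

/-- The root operator `ẽ_α p = p + ½ (ẽ p_α - p_α) α` (and `0` if `ẽ p_α = 0`). -/
def rootE (i : ι) (p : PathMap V) : Option (PathMap V) :=
  (rankOneE (proj R i p)).map fun x =>
    ofFun p.len p.len_nonneg
      (fun t => p.toFun t + ((1 / 2 : ℝ) * (x.toFun t - (proj R i p).toFun t)) • R.root i)
      (by simp [PathMap.eq_zero_of_le])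

/-- The characteristic properties of a pair of operators `e, f : B_univ → B_univ ∪ {0}`
for the `i`-th root (`none` is `0`). -/
structure IsRootOperatorPair (i : ι) (e f : PathMap V → Option (PathMap V)) : Prop where
  mem_f : ∀ p ∈ BUniv R, ∀ q, f p = some q → q ∈ BUniv R
  mem_e : ∀ p ∈ BUniv R, ∀ q, e p = some q → q ∈ BUniv R
  e_f : ∀ p ∈ BUniv R, ∀ q, f p = some q → e q = some p
  f_e : ∀ p ∈ BUniv R, ∀ q, e p = some q → f q = some p
  line : ∀ μ ∈ weightLattice R, ∀ n : ℕ, 0 < n → R.toLinearMap μ (R.coroot i) = n →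
    power f n (PathMap.line μ) = some (PathMap.line (R.reflection i μ))
  /-- The tensor product rule, for `d_i^+(p)` and `d_i^-(q)` (nonnegative) integers. -/
  concat : ∀ p ∈ BUniv R, ∀ q ∈ BUniv R, ∀ a c : ℕ, dP R i p = a → dM R i q = c →
    f (p.concat q) = (if a > c then (f p).map (·.concat q) else (f q).map p.concat) ∧
    e (p.concat q) = (if a ≥ c then (e p).map (·.concat q) else (e q).map p.concat)
  /-- Stretching by integers `r ≥ 0`, with the meaningless case `0 · 0` left out. -/
  stretch_f : ∀ p ∈ BUniv R, ∀ r : ℕ, (0 < r ∨ f p ≠ none) →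
    power f r (p.stretch r) = (f p).map (stretch r)
  stretch_e : ∀ p ∈ BUniv R, ∀ r : ℕ, (0 < r ∨ e p ≠ none) →
    power e r (p.stretch r) = (e p).map (stretch r)
  reverse_f : ∀ p ∈ BUniv R, f p.reverse = (e p).map reverse
  reverse_e : ∀ p ∈ BUniv R, e p.reverse = (f p).map reverse
  wt_f : ∀ p ∈ BUniv R, ∀ q, f p = some q → q.wt = p.wt - R.root i
  wt_e : ∀ p ∈ BUniv R, ∀ q, e p = some q → q.wt = p.wt + R.root i

open Classical in
/-- The tensor product rule for arbitrary real values of `d_i^+(p)` and `d_i^-(q)`, as far as these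
do not differ by a fraction of a unit in the critical direction. -/
def TensorRule (i : ι) (e f : PathMap V → Option (PathMap V)) : Prop :=
  ∀ p ∈ BUniv R, ∀ q ∈ BUniv R,
    (dP R i p - dM R i q ∉ Set.Ioo (0 : ℝ) 1 →
      f (p.concat q) =
        if dP R i p > dM R i q then (f p).map (·.concat q) else (f q).map p.concat) ∧
    (dM R i q - dP R i p ∉ Set.Ioo (0 : ℝ) 1 →
      e (p.concat q) =
        if dP R i p ≥ dM R i q then (e p).map (·.concat q) else (e q).map p.concat)

end RootPaths

end

/-! Everything rests on one construction with a real parameter. Let φ be the pairing with the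
coroot, F(t) the infimum of φ∘p on [t, ∞) and m the minimum of φ∘p. For a ≥ 0, `lower` subtracts
min(a, F − m)·α from p: it reflects the first a units of the rise of p above its minimum. The root
operator f̃ is the case a = 1, defined when the rise is at least 1; the rank one operator is the
same thing for V = ℝ, φ = id, α = 2. In both settings ẽ is f̃ conjugated by reversal, so half of the
statements come for free.

Real parameters make the construction divisible. On p ⊗ q the amount a splits into b = min(a, max(0,
rise p − fall q)) on p and a − b on q (`lower_concat`); stretching scales a (`lower_stretch`);
lowering is additive as long as there is rise left (`lower_lower`) and is undone by raising
(`raise_lower`). The tensor rule is the case where b is 0 or 1, and the pairing procedure is its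
iteration along a word. Induction over segments shows that the generated paths are stable
(`lower_mem`). The graphs are closed because the rise and the lowered path depend continuously on
the path, and 1 ≤ rise is a closed condition.

For uniqueness, reversal determines e from f. The line and stretching axioms fix f on a segment of
height 1, and the axioms force f to vanish on paths of rise 0 and integral fall (`f_eq_none`), the
one case they do not prescribe directly. On concatenations of segments of height 1, −1 or 0 the
rises and falls are integers, so the tensor rule computes f; an integer stretch brings every
rational path into this form, and the stretching axiom descends to the path itself. A path of rise
at least 1 is a limit of rational paths of no smaller rise, so the closed graph fixes f there. If
the rise is below 1 and f p = x, then x* has rise at least 1, where f is already known, and reversal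
gives a contradiction. -/

noncomputable section

namespace PathMap

/-! ### Algebra of concatenation, reversal and stretching. -/

section Algebra

variable {V : Type*} [AddCommGroup V]

theorem toFun_zero (p : PathMap V) : p.toFun 0 = 0 := p.eq_zero_of_le 0 le_rfl

theorem ofFun_toFun_of_const {ℓ : ℝ} (hℓ : 0 ≤ ℓ) {g : ℝ → V} (hg : g 0 = 0)
    (h0 : ∀ t ≤ 0, g t = 0) (h1 : ∀ t, ℓ ≤ t → g t = g ℓ) (t : ℝ) :
    (ofFun ℓ hℓ g hg).toFun t = g t := by
  change g (max 0 (min t ℓ)) = g t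
  rcases le_total t 0 with ht | ht
  · rw [min_eq_left (ht.trans hℓ), max_eq_left ht, hg, h0 t ht]
  · rcases le_total t ℓ with h | h
    · rw [min_eq_left h, max_eq_right ht]
    · rw [min_eq_right h, max_eq_right hℓ, h1 t h]

@[simp] theorem len_concat (p q : PathMap V) : (p.concat q).len = p.len + q.len := rfl

@[simp] theorem len_reverse (p : PathMap V) : p.reverse.len = p.len := rfl

/-- Both maps are constant outside their intervals, so the case distinction disappears and
concatenation becomes a sum with a shift of time. -/
theorem concat_toFun (p q : PathMap V) (t : ℝ) :
    (p.concat q).toFun t = p.toFun t + q.toFun (t - p.len) := by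
  have hp := p.len_nonneg
  have hq := q.len_nonneg
  have key : ∀ s, (if s ≤ p.len then p.toFun s else p.toFun p.len + q.toFun (s - p.len))
      = p.toFun s + q.toFun (s - p.len) := by
    intro s
    split_ifs with h
    · rw [q.eq_zero_of_le _ (by linarith), add_zero]
    · rw [p.eq_end_of_ge s (by linarith)]
  unfold concat
  rw [ofFun_toFun_of_const, key]
  · intro s hs
    rw [key, p.eq_zero_of_le s hs, q.eq_zero_of_le _ (by linarith), add_zero]
  · intro s hs
    rw [key, key, p.eq_end_of_ge s (by linarith), p.eq_end_of_ge (p.len + q.len) (by linarith),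
      q.eq_end_of_ge (s - p.len) (by linarith), q.eq_end_of_ge (p.len + q.len - p.len) (by linarith)]

theorem reverse_toFun (p : PathMap V) (t : ℝ) :
    p.reverse.toFun t = p.toFun (p.len - t) - p.toFun p.len := by
  unfold reverse
  rw [ofFun_toFun_of_const]
  · intro s hs
    rw [p.eq_end_of_ge (p.len - s) (by linarith), sub_self]
  · intro s hs
    rw [p.eq_zero_of_le (p.len - s) (by linarith), p.eq_zero_of_le (p.len - p.len) (by linarith)]

theorem concat_assoc (p q r : PathMap V) :
    (p.concat q).concat r = p.concat (q.concat r) := by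
  ext t
  · simp [add_assoc]
  · simp [concat_toFun, add_assoc, sub_sub]

@[simp] theorem reverse_reverse (p : PathMap V) : p.reverse.reverse = p := by
  ext t
  · rfl
  · simp [reverse_toFun, toFun_zero]

theorem wt_concat (p q : PathMap V) : (p.concat q).wt = p.wt + q.wt := by
  simp only [wt, len_concat, concat_toFun]
  rw [p.eq_end_of_ge _ (by linarith [q.len_nonneg]), add_sub_cancel_left]

theorem wt_reverse (p : PathMap V) : p.reverse.wt = -p.wt := by
  simp [wt, reverse_toFun, toFun_zero]

theorem reverse_concat (p q : PathMap V) :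
    (p.concat q).reverse = q.reverse.concat p.reverse := by
  ext t
  · simp [add_comm]
  · have h1 := wt_concat p q
    simp only [wt] at h1
    simp only [reverse_toFun, h1]
    simp only [concat_toFun, reverse_toFun, len_concat, len_reverse]
    rw [show p.len + q.len - t - p.len = q.len - t by ring,
      show p.len - (t - q.len) = p.len + q.len - t by ring]
    abel

/-- The map of length zero. -/
def trivial (V : Type*) [AddCommGroup V] : PathMap V := ofFun 0 le_rfl (fun _ => 0) rfl

theorem trivial_toFun (t : ℝ) : (trivial V).toFun t = 0 := rfl

@[simp] theorem len_trivial : (trivial V).len = 0 := rfl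

@[simp] theorem concat_trivial (p : PathMap V) : p.concat (trivial V) = p := by
  ext t
  · simp
  · simp [concat_toFun, trivial_toFun]

@[simp] theorem trivial_concat (p : PathMap V) : (trivial V).concat p = p := by
  ext t
  · simp
  · simp [concat_toFun, trivial_toFun]

variable [Module ℝ V]

@[simp] theorem len_stretch (r : ℝ≥0) (p : PathMap V) : (p.stretch r).len = r * p.len := rfl

@[simp] theorem len_line (μ : V) : (line μ).len = 1 := rfl

theorem line_toFun (μ : V) (t : ℝ) : (line μ).toFun t = (max 0 (min t 1)) • μ := rfl

theorem stretch_toFun (r : ℝ≥0) (p : PathMap V) (t : ℝ) :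
    (p.stretch r).toFun t = (r : ℝ) • p.toFun (t / r) := by
  have hr := r.coe_nonneg
  unfold stretch
  rw [ofFun_toFun_of_const]
  · intro s hs
    rw [p.eq_zero_of_le _ (div_nonpos_of_nonpos_of_nonneg hs hr), smul_zero]
  · intro s hs
    rcases hr.eq_or_lt with h | h
    · simp [← h]
    · rw [p.eq_end_of_ge (s / r) (by rw [le_div_iff₀ h]; linarith), mul_div_cancel_left₀ _ h.ne']

theorem wt_stretch (r : ℝ≥0) (p : PathMap V) : (p.stretch r).wt = (r : ℝ) • p.wt := by
  rcases eq_or_ne r 0 with rfl | h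
  · simp [wt, stretch_toFun]
  · have : (r : ℝ) ≠ 0 := by exact_mod_cast h
    simp [wt, stretch_toFun, mul_div_cancel_left₀ _ this]

theorem wt_line (μ : V) : (line μ).wt = μ := by
  simp [wt, line_toFun]

theorem stretch_concat (r : ℝ≥0) (p q : PathMap V) :
    (p.concat q).stretch r = (p.stretch r).concat (q.stretch r) := by
  rcases eq_or_ne r 0 with rfl | h
  · ext t
    · simp
    · simp [stretch_toFun, concat_toFun]
  · have : (r : ℝ) ≠ 0 := by exact_mod_cast h
    ext t
    · simp [mul_add]
    · simp only [stretch_toFun, concat_toFun, len_stretch, smul_add]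
      congr 3
      field_simp

theorem reverse_stretch (r : ℝ≥0) (p : PathMap V) :
    (p.stretch r).reverse = p.reverse.stretch r := by
  rcases eq_or_ne r 0 with rfl | h
  · ext t
    · simp
    · simp [stretch_toFun, reverse_toFun]
  · have : (r : ℝ) ≠ 0 := by exact_mod_cast h
    ext t
    · simp
    · simp only [stretch_toFun, reverse_toFun, len_stretch, smul_sub]
      congr 3 <;> field_simp

theorem stretch_stretch (r s : ℝ≥0) (p : PathMap V) :
    (p.stretch s).stretch r = p.stretch (r * s) := by
  ext t
  · simp [mul_assoc]
  · simp only [stretch_toFun, smul_smul, NNReal.coe_mul]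
    congr 2
    rw [div_div]

@[simp] theorem stretch_one (p : PathMap V) : p.stretch 1 = p := by
  ext t
  · simp
  · simp [stretch_toFun]

theorem stretch_injective {r : ℝ≥0} (hr : r ≠ 0) :
    Function.Injective (stretch r : PathMap V → PathMap V) := by
  apply Function.LeftInverse.injective (g := stretch r⁻¹)
  intro p
  rw [stretch_stretch, inv_mul_cancel₀ hr, stretch_one]

theorem stretch_line_toFun (r : ℝ≥0) (μ : V) (t : ℝ) :
    ((line μ).stretch r).toFun t = (max 0 (min t r)) • μ := by
  rw [stretch_toFun, line_toFun, smul_smul]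
  congr 1
  have hr := r.coe_nonneg
  rcases hr.eq_or_lt with h | h
  · rw [← h]; simp
  · rw [mul_max_of_nonneg _ _ hr, mul_min_of_nonneg _ _ hr, mul_div_cancel₀ _ h.ne']
    simp

theorem stretch_add_line (r s : ℝ≥0) (μ : V) :
    (line μ).stretch (r + s) = ((line μ).stretch r).concat ((line μ).stretch s) := by
  ext t
  · simp
  · rw [concat_toFun, stretch_line_toFun, stretch_line_toFun, stretch_line_toFun, ← add_smul]
    congr 1
    have hr := r.coe_nonneg
    have hs := s.coe_nonneg
    simp only [len_stretch, len_line, NNReal.coe_add, mul_one, max_def, min_def]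
    split_ifs <;> linarith

theorem reverse_line (μ : V) : (line μ).reverse = line (-μ) := by
  ext t
  · rfl
  · rw [reverse_toFun, line_toFun, line_toFun, line_toFun, smul_neg, ← neg_smul, ← sub_smul]
    congr 1
    simp only [len_line, max_def, min_def]
    split_ifs <;> linarith

theorem stretch_zero (p : PathMap V) : p.stretch 0 = trivial V := by
  ext t
  · simp
  · simp [stretch_toFun, trivial_toFun]

end Algebra

end PathMap

end

noncomputable section

namespace PathMap

/-! ### Heights, minima, and lowering by a real amount. -/

section Lowering

variable {V : Type*} [AddCommGroup V] [Module ℝ V] (φ : V →ₗ[ℝ] ℝ) (α : V)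

/-- The height function `φ ∘ p` is Lipschitz. -/
def IsTame (p : PathMap V) : Prop := ∃ C, LipschitzWith C (fun t => φ (p.toFun t))

/-- The infimum of the height `φ ∘ p` on `[t, ∞)`. -/
def future (p : PathMap V) (t : ℝ) : ℝ := sInf ((fun s => φ (p.toFun s)) '' Set.Ici t)

/-- The infimum of the height `φ ∘ p` on `(-∞, t]`. -/
def past (p : PathMap V) (t : ℝ) : ℝ := sInf ((fun s => φ (p.toFun s)) '' Set.Iic t)

/-- The infimum of the height `φ ∘ p`. -/
def base (p : PathMap V) : ℝ := future φ p 0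

/-- The rise of `p` above its minimum at the end. -/
def rise (p : PathMap V) : ℝ := φ p.wt - base φ p

/-- The fall of `p` from its start to its minimum. -/
def fall (p : PathMap V) : ℝ := -base φ p

/-- The amount by which the first `a` units of the rise have been passed at time `t`. -/
def gain (a : ℝ) (p : PathMap V) (t : ℝ) : ℝ := max 0 (min a (future φ p t - base φ p))

variable {φ}

theorem IsTame.continuous {p : PathMap V} (hp : IsTame φ p) :
    Continuous (fun t => φ (p.toFun t)) := hp.choose_spec.continuous

theorem IsTame.exists_abs_le {p : PathMap V} (hp : IsTame φ p) :
    ∃ B, ∀ t, |φ (p.toFun t)| ≤ B := by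
  obtain ⟨C, hC⟩ := hp
  refine ⟨C * p.len, fun t => ?_⟩
  have hl := p.len_nonneg
  have hC0 := C.coe_nonneg
  have key : ∀ s, 0 ≤ s → s ≤ p.len → |φ (p.toFun s)| ≤ C * p.len := by
    intro s h0 h1
    have := hC.dist_le_mul s 0
    simp only [Real.dist_eq, p.toFun_zero, map_zero, sub_zero, abs_of_nonneg h0] at this
    exact this.trans (mul_le_mul_of_nonneg_left h1 hC0)
  rcases le_total t 0 with h | h
  · rw [p.eq_zero_of_le t h, map_zero, abs_zero]; positivity
  · rcases le_total t p.len with h' | h'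
    · exact key t h h'
    · rw [p.eq_end_of_ge t h']; exact key _ hl le_rfl

/-- The height of `p` is bounded below. -/
def HeightBdd (φ : V →ₗ[ℝ] ℝ) (p : PathMap V) : Prop := ∃ B, ∀ t, B ≤ φ (p.toFun t)

theorem IsTame.heightBdd {p : PathMap V} (hp : IsTame φ p) : HeightBdd φ p := by
  obtain ⟨B, hB⟩ := hp.exists_abs_le
  exact ⟨-B, fun t => neg_le_of_abs_le (hB t)⟩

/-- Boundedness keeps `sInf` away from its default value. Identities between infima are proved below
by comparing their lower bounds through this equivalence. -/
theorem le_future_iff {p : PathMap V} (hp : HeightBdd φ p) {c t : ℝ} :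
    c ≤ future φ p t ↔ ∀ s, t ≤ s → c ≤ φ (p.toFun s) := by
  obtain ⟨B, hB⟩ := hp
  have hbdd : BddBelow ((fun s => φ (p.toFun s)) '' Set.Ici t) :=
    ⟨B, by rintro _ ⟨s, -, rfl⟩; exact hB s⟩
  unfold future
  rw [le_csInf_iff hbdd (Set.nonempty_Ici.image _)]
  simp

theorem le_past_iff {p : PathMap V} (hp : HeightBdd φ p) {c t : ℝ} :
    c ≤ past φ p t ↔ ∀ s, s ≤ t → c ≤ φ (p.toFun s) := by
  obtain ⟨B, hB⟩ := hp
  have hbdd : BddBelow ((fun s => φ (p.toFun s)) '' Set.Iic t) :=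
    ⟨B, by rintro _ ⟨s, -, rfl⟩; exact hB s⟩
  unfold past
  rw [le_csInf_iff hbdd (Set.nonempty_Iic.image _)]
  simp

theorem future_of_nonpos (p : PathMap V) {t : ℝ} (ht : t ≤ 0) : future φ p t = base φ p := by
  unfold base future
  congr 1
  apply Set.Subset.antisymm
  · rintro _ ⟨s, hs, rfl⟩
    rcases le_total s 0 with h | h
    · exact ⟨0, Set.self_mem_Ici, by simp [p.eq_zero_of_le s h, p.toFun_zero]⟩
    · exact ⟨s, h, rfl⟩
  · exact Set.image_mono (Set.Ici_subset_Ici.2 ht)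

theorem le_base_iff {p : PathMap V} (hp : HeightBdd φ p) {c : ℝ} :
    c ≤ base φ p ↔ ∀ s, c ≤ φ (p.toFun s) := by
  refine ⟨fun h s => ?_, fun h => (le_future_iff hp).2 fun s _ => h s⟩
  rw [← future_of_nonpos p (min_le_right s 0)] at h
  exact (le_future_iff hp).1 h s (min_le_left s 0)

theorem future_of_len_le (p : PathMap V) {t : ℝ} (ht : p.len ≤ t) : future φ p t = φ p.wt := by
  unfold future
  have : (fun s => φ (p.toFun s)) '' Set.Ici t = {φ p.wt} := by
    apply Set.Subset.antisymm
    · rintro _ ⟨s, hs, rfl⟩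
      simp [p.eq_end_of_ge s (ht.trans hs), wt]
    · rintro _ rfl
      exact ⟨t, Set.self_mem_Ici, by simp [p.eq_end_of_ge t ht, wt]⟩
  rw [this, csInf_singleton]

theorem future_le {p : PathMap V} (hp : HeightBdd φ p) {t s : ℝ} (h : t ≤ s) :
    future φ p t ≤ φ (p.toFun s) := (le_future_iff hp).1 le_rfl s h

theorem future_mono {p : PathMap V} (hp : HeightBdd φ p) {t s : ℝ} (h : t ≤ s) :
    future φ p t ≤ future φ p s :=
  (le_future_iff hp).2 fun _ hu => future_le hp (h.trans hu)

theorem base_le_future {p : PathMap V} (hp : HeightBdd φ p) (t : ℝ) :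
    base φ p ≤ future φ p t := by
  rw [← future_of_nonpos p (min_le_right t 0)]
  exact future_mono hp (min_le_left _ _)

theorem base_le {p : PathMap V} (hp : HeightBdd φ p) (t : ℝ) : base φ p ≤ φ (p.toFun t) :=
  (le_base_iff hp).1 le_rfl t

theorem past_le {p : PathMap V} (hp : HeightBdd φ p) {t s : ℝ} (h : s ≤ t) :
    past φ p t ≤ φ (p.toFun s) := (le_past_iff hp).1 le_rfl s h

theorem future_le_wt {p : PathMap V} (hp : HeightBdd φ p) (t : ℝ) :
    future φ p t ≤ φ p.wt := by
  rw [← future_of_len_le p (le_max_right t p.len)]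
  exact future_mono hp (le_max_left _ _)

theorem fall_nonneg {p : PathMap V} (hp : HeightBdd φ p) : 0 ≤ fall φ p := by
  have := base_le hp 0
  rw [p.toFun_zero, map_zero] at this
  unfold fall; linarith

theorem rise_nonneg {p : PathMap V} (hp : HeightBdd φ p) : 0 ≤ rise φ p :=
  sub_nonneg.2 (base_le hp p.len)

theorem rise_sub_fall (p : PathMap V) : rise φ p - fall φ p = φ p.wt := by
  unfold rise fall; ring

theorem gain_eq {p : PathMap V} (hp : HeightBdd φ p) {a : ℝ} (ha : 0 ≤ a) (t : ℝ) :
    gain φ a p t = min a (future φ p t - base φ p) :=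
  max_eq_right (le_min ha (sub_nonneg.2 (base_le_future hp t)))

variable (φ)

/-- The path `p` with the first `a` units of its rise reflected in `α`. -/
def lower (a : ℝ) (p : PathMap V) : PathMap V where
  len := p.len
  toFun t := p.toFun t - gain φ a p t • α
  len_nonneg := p.len_nonneg
  eq_zero_of_le t ht := by
    simp [p.eq_zero_of_le t ht, gain, future_of_nonpos p ht]
  eq_end_of_ge t ht := by
    simp [p.eq_end_of_ge t ht, gain, future_of_len_le p ht, future_of_len_le p le_rfl]

/-- The path `p` with the last `a` units of its fall reflected in `α`. -/
def raise (a : ℝ) (p : PathMap V) : PathMap V := (lower φ α a p.reverse).reverse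

variable {φ α}

@[simp] theorem len_lower (a : ℝ) (p : PathMap V) : (lower φ α a p).len = p.len := rfl

@[simp] theorem len_raise (a : ℝ) (p : PathMap V) : (raise φ α a p).len = p.len := rfl

theorem lower_toFun (a : ℝ) (p : PathMap V) (t : ℝ) :
    (lower φ α a p).toFun t = p.toFun t - gain φ a p t • α := rfl

theorem lower_zero (p : PathMap V) : lower φ α 0 p = p := by
  ext t
  · rfl
  · rw [lower_toFun, gain, max_eq_left (min_le_left _ _), zero_smul, sub_zero]

/-! ### Behaviour under concatenation and stretching. -/

theorem HeightBdd.concat {p q : PathMap V} (hp : HeightBdd φ p) (hq : HeightBdd φ q) :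
    HeightBdd φ (p.concat q) := by
  obtain ⟨B, hB⟩ := hp
  obtain ⟨C, hC⟩ := hq
  refine ⟨B + C, fun t => ?_⟩
  rw [concat_toFun, map_add]
  exact add_le_add (hB _) (hC _)

theorem future_concat_of_le {p q : PathMap V} (hp : HeightBdd φ p) (hq : HeightBdd φ q) {t : ℝ}
    (ht : t ≤ p.len) :
    future φ (p.concat q) t = min (future φ p t) (φ p.wt + base φ q) := by
  refine eq_of_forall_le_iff fun c => ?_
  rw [le_future_iff (hp.concat hq), le_min_iff, le_future_iff hp, ← sub_le_iff_le_add',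
    le_base_iff hq]
  simp only [concat_toFun, map_add]
  constructor
  · intro h
    constructor
    · intro s hs
      rcases le_total s p.len with h' | h'
      · have := h s hs
        rwa [q.eq_zero_of_le _ (by linarith), map_zero, add_zero] at this
      · have := h p.len ht
        rw [sub_self, q.toFun_zero, map_zero, add_zero] at this
        rwa [p.eq_end_of_ge s h']
    · intro s
      rcases le_total s 0 with h' | h'
      · have := h p.len ht
        rw [sub_self, q.toFun_zero, map_zero, add_zero] at this
        rw [q.eq_zero_of_le s h', map_zero]
        exact sub_nonpos.2 this
      · have := h (p.len + s) (by linarith)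
        rw [p.eq_end_of_ge _ (by linarith), add_sub_cancel_left] at this
        exact sub_le_iff_le_add'.2 this
  · rintro ⟨h1, h2⟩ s hs
    rcases le_total s p.len with h' | h'
    · rw [q.eq_zero_of_le _ (by linarith), map_zero, add_zero]
      exact h1 s hs
    · rw [p.eq_end_of_ge s h']
      exact sub_le_iff_le_add'.1 (h2 _)

theorem future_concat_of_ge {p q : PathMap V} (hp : HeightBdd φ p) (hq : HeightBdd φ q) {t : ℝ}
    (ht : p.len ≤ t) :
    future φ (p.concat q) t = φ p.wt + future φ q (t - p.len) := by
  refine eq_of_forall_le_iff fun c => ?_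
  rw [le_future_iff (hp.concat hq), ← sub_le_iff_le_add', le_future_iff hq]
  simp only [concat_toFun, map_add]
  constructor
  · intro h s hs
    have := h (p.len + s) (by linarith)
    rw [p.eq_end_of_ge _ (by linarith), add_sub_cancel_left] at this
    exact sub_le_iff_le_add'.2 this
  · intro h s hs
    rw [p.eq_end_of_ge s (by linarith)]
    exact sub_le_iff_le_add'.1 (h _ (by linarith))

theorem base_concat {p q : PathMap V} (hp : HeightBdd φ p) (hq : HeightBdd φ q) :
    base φ (p.concat q) = min (base φ p) (φ p.wt + base φ q) :=
  future_concat_of_le hp hq p.len_nonneg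

/-- The continuous form of pairing: the rise of `p` cancels against the fall of `q`, and only the
excess survives. -/
theorem rise_concat {p q : PathMap V} (hp : HeightBdd φ p) (hq : HeightBdd φ q) :
    rise φ (p.concat q) = rise φ q + max 0 (rise φ p - fall φ q) := by
  unfold rise fall
  rw [base_concat hp hq, wt_concat, map_add, min_def, max_def]
  split_ifs <;> linarith

theorem fall_concat {p q : PathMap V} (hp : HeightBdd φ p) (hq : HeightBdd φ q) :
    fall φ (p.concat q) = fall φ p + max 0 (fall φ q - rise φ p) := by
  unfold rise fall
  rw [base_concat hp hq, min_def, max_def]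
  split_ifs <;> linarith

/-- The part of the rise of `p` not cancelled by the fall of `q` comes first in time, so it absorbs
as much of `a` as it can, namely `b`; the remainder goes to `q`. The cases are: `t` before or after
the joint, and the minimum of the concatenation in `p` or in `q`. -/
theorem gain_concat {p q : PathMap V} (hp : HeightBdd φ p) (hq : HeightBdd φ q) {a b : ℝ}
    (ha : 0 ≤ a) (hb : b = min a (max 0 (rise φ p - fall φ q))) (t : ℝ) :
    gain φ a (p.concat q) t = gain φ b p t + gain φ (a - b) q (t - p.len) := by
  have hb0 : 0 ≤ b := by rw [hb]; exact le_min ha (le_max_left _ _)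
  have hba : 0 ≤ a - b := by rw [hb]; exact sub_nonneg.2 (min_le_left _ _)
  rw [gain_eq (hp.concat hq) ha, gain_eq hp hb0, gain_eq hq hba, base_concat hp hq]
  have h1 := base_le_future hp t
  have h2 := base_le_future hq (t - p.len)
  have h3 := future_le_wt hp t
  have h4 : base φ q ≤ 0 := by have := fall_nonneg hq; unfold fall at this; linarith
  unfold rise fall at hb
  rcases le_total t p.len with ht | ht
  · rw [future_concat_of_le hp hq ht, future_of_nonpos q (sub_nonpos.2 ht), sub_self,
      min_eq_right hba, add_zero]
    rcases le_total (base φ p) (φ p.wt + base φ q) with h | h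
    · rw [max_eq_right (by linarith)] at hb
      rw [min_eq_left h, hb]
      simp only [min_def]
      split_ifs <;> linarith
    · rw [max_eq_left (by linarith), min_eq_right ha] at hb
      rw [min_eq_right h, min_eq_right (h.trans h1), hb, sub_self, min_eq_right ha,
        min_eq_left (sub_nonneg.2 h1)]
  · rw [future_concat_of_ge hp hq ht, future_of_len_le p ht]
    rcases le_total (base φ p) (φ p.wt + base φ q) with h | h
    · rw [max_eq_right (by linarith)] at hb
      rw [min_eq_left h, hb]
      simp only [min_def]
      split_ifs <;> linarith
    · rw [max_eq_left (by linarith), min_eq_right ha] at hb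
      rw [min_eq_right h, hb, sub_zero, min_eq_left (a := 0) (by linarith), zero_add,
        add_sub_add_left_eq_sub]

theorem lower_concat {p q : PathMap V} (hp : HeightBdd φ p) (hq : HeightBdd φ q) {a b : ℝ}
    (ha : 0 ≤ a) (hb : b = min a (max 0 (rise φ p - fall φ q))) :
    lower φ α a (p.concat q) = (lower φ α b p).concat (lower φ α (a - b) q) := by
  ext t
  · rfl
  · simp only [concat_toFun, lower_toFun, gain_concat hp hq ha hb, len_lower]
    module

theorem HeightBdd.stretch {p : PathMap V} (hp : HeightBdd φ p) (r : ℝ≥0) :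
    HeightBdd φ (p.stretch r) := by
  obtain ⟨B, hB⟩ := hp
  refine ⟨r * B, fun t => ?_⟩
  rw [stretch_toFun, map_smul, smul_eq_mul]
  exact mul_le_mul_of_nonneg_left (hB _) r.coe_nonneg

theorem HeightBdd.lower {p : PathMap V} (hp : HeightBdd φ p) {a : ℝ} (ha : 0 ≤ a)
    (hα : φ α = 2) : HeightBdd φ (lower φ α a p) := by
  obtain ⟨B, hB⟩ := id hp
  refine ⟨B - 2 * a, fun t => ?_⟩
  have h := min_le_left a (future φ p t - base φ p)
  rw [lower_toFun, gain_eq hp ha, map_sub, map_smul, hα, smul_eq_mul]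
  linarith [hB t]

theorem future_stretch {p : PathMap V} (hp : HeightBdd φ p) (r : ℝ≥0) (t : ℝ) :
    future φ (p.stretch r) t = r * future φ p (t / r) := by
  rcases eq_or_ne r 0 with rfl | h
  · rw [stretch_zero]
    simp only [future, trivial_toFun, map_zero, NNReal.coe_zero, zero_mul]
    rw [Set.nonempty_Ici.image_const, csInf_singleton]
  · have hr : (0 : ℝ) < r := by exact_mod_cast pos_iff_ne_zero.2 h
    refine eq_of_forall_le_iff fun c => ?_
    rw [le_future_iff (hp.stretch r), ← div_le_iff₀' hr, le_future_iff hp]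
    simp only [stretch_toFun, map_smul, smul_eq_mul, ← div_le_iff₀' hr]
    constructor
    · intro H s hs
      have := H (s * r) (by rwa [div_le_iff₀ hr] at hs)
      rwa [mul_div_cancel_right₀ _ hr.ne'] at this
    · intro H s hs
      exact H _ (div_le_div_of_nonneg_right hs hr.le)

theorem base_stretch {p : PathMap V} (hp : HeightBdd φ p) (r : ℝ≥0) :
    base φ (p.stretch r) = r * base φ p := by
  rw [base, future_stretch hp, zero_div]; rfl

theorem rise_stretch {p : PathMap V} (hp : HeightBdd φ p) (r : ℝ≥0) :
    rise φ (p.stretch r) = r * rise φ p := by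
  rw [rise, base_stretch hp, wt_stretch, map_smul, smul_eq_mul, rise, mul_sub]

theorem fall_stretch {p : PathMap V} (hp : HeightBdd φ p) (r : ℝ≥0) :
    fall φ (p.stretch r) = r * fall φ p := by
  rw [fall, base_stretch hp, fall, mul_neg]

theorem lower_stretch {p : PathMap V} (hp : HeightBdd φ p) (r : ℝ≥0) (a : ℝ) :
    lower φ α (r * a) (p.stretch r) = (lower φ α a p).stretch r := by
  ext t
  · rfl
  · have : gain φ (r * a) (p.stretch r) t = r * gain φ a p (t / r) := by
      unfold gain
      rw [future_stretch hp, base_stretch hp, ← mul_sub, ← mul_min_of_nonneg _ _ r.coe_nonneg,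
        mul_max_of_nonneg _ _ r.coe_nonneg, mul_zero]
    rw [lower_toFun, stretch_toFun, stretch_toFun, lower_toFun, this, smul_sub, mul_smul]

/-! ### Last passage times, additivity and invertibility of lowering. -/

/-- The witness is the last time in `[t₁, t₂]` at which the height is at most `c`. Afterwards the
height stays at least `c`, and by continuity it equals `c` at that time. -/
theorem exists_eq_future {p : PathMap V} (hp : IsTame φ p) {t₁ t₂ c : ℝ}
    (h₁ : future φ p t₁ < c) (h₂ : c ≤ future φ p t₂) :
    ∃ s, t₁ ≤ s ∧ s ≤ t₂ ∧ φ (p.toFun s) = c ∧ future φ p s = c := by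
  have hb := hp.heightBdd
  have hcont := hp.continuous
  have hcpt : IsCompact (Set.Icc t₁ t₂ ∩ {s | φ (p.toFun s) ≤ c}) :=
    isCompact_Icc.inter_right (isClosed_le hcont continuous_const)
  have hlt : ∀ s, t₂ ≤ s → c ≤ φ (p.toFun s) := fun s hs => h₂.trans (future_le hb hs)
  have hne : (Set.Icc t₁ t₂ ∩ {s | φ (p.toFun s) ≤ c}).Nonempty := by
    by_contra hcon
    refine h₁.not_ge ((le_future_iff hb).2 fun s hs => ?_)
    rcases le_total s t₂ with h | h
    · by_contra hs'
      exact hcon ⟨s, ⟨hs, h⟩, (not_le.1 hs').le⟩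
    · exact hlt s h
  obtain ⟨s, ⟨hs, hsc⟩, hmax⟩ := hcpt.exists_isGreatest hne
  have hsc : φ (p.toFun s) ≤ c := hsc
  have hgt : ∀ u, s < u → c ≤ φ (p.toFun u) := by
    intro u hu
    rcases le_total u t₂ with h | h
    · by_contra hc
      exact absurd (hmax ⟨⟨hs.1.trans hu.le, h⟩, (not_le.1 hc).le⟩) (not_le.2 hu)
    · exact hlt u h
  -- The bound holds at all later times and passes to the limit from the right.
  have hge : c ≤ φ (p.toFun s) :=
    ge_of_tendsto (hcont.continuousWithinAt (s := Set.Ioi s) (x := s)).tendsto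
      (Filter.eventually_of_mem self_mem_nhdsWithin hgt)
  refine ⟨s, hs.1, hs.2, le_antisymm hsc hge, le_antisymm ((future_le hb le_rfl).trans hsc) ?_⟩
  refine (le_future_iff hb).2 fun u hu => ?_
  rcases hu.eq_or_lt with rfl | h
  · exact hge
  · exact hgt u h

theorem height_lower {p : PathMap V} (hp : HeightBdd φ p) (hα : φ α = 2) {a : ℝ} (ha : 0 ≤ a)
    (t : ℝ) : φ ((lower φ α a p).toFun t)
      = φ (p.toFun t) - 2 * min a (future φ p t - base φ p) := by
  rw [lower_toFun, gain_eq hp ha, map_sub, map_smul, hα, smul_eq_mul, mul_comm]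

/-- Once the first `a` units have been passed, the path is shifted down by `2a`. Before that, the
last passage at height `base + a` is still ahead and is moved to the new minimum `base - a`; it
exists because `a ≤ rise`. -/
theorem future_lower {p : PathMap V} (hp : IsTame φ p) (hα : φ α = 2) {a : ℝ} (ha : 0 ≤ a)
    (har : a ≤ rise φ p) (t : ℝ) :
    future φ (lower φ α a p) t = max (base φ p - a) (future φ p t - 2 * a) := by
  have hb := hp.heightBdd
  have hl := hb.lower ha hα
  apply le_antisymm
  · rcases le_or_gt (base φ p + a) (future φ p t) with h | h
    · rw [max_eq_right (by linarith), le_sub_iff_add_le, le_future_iff hb]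
      intro s hs
      have h1 := future_le hl hs
      rw [height_lower hb hα ha, min_eq_left (by linarith [future_mono hb hs])] at h1
      linarith
    · obtain ⟨s, hs, -, h1, h2⟩ := exists_eq_future hp (t₂ := max t p.len) h (by
        rw [future_of_len_le p (le_max_right _ _)]; unfold rise at har; linarith)
      have h3 := future_le hl hs
      rw [height_lower hb hα ha, h1, h2, min_eq_left (by linarith)] at h3
      exact (show _ ≤ _ by linarith : _ ≤ base φ p - a).trans (le_max_left _ _)
  · refine (le_future_iff hl).2 fun s hs => ?_
    rw [height_lower hb hα ha]
    have h1 := future_mono hb hs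
    have h2 := future_le hb (le_refl s)
    have h3 := base_le_future hb s
    rcases le_total a (future φ p s - base φ p) with h | h
    · rw [min_eq_left h]
      exact max_le (by linarith) (by linarith)
    · rw [min_eq_right h]
      exact max_le (by linarith) (by linarith)

theorem base_lower {p : PathMap V} (hp : IsTame φ p) (hα : φ α = 2) {a : ℝ} (ha : 0 ≤ a)
    (har : a ≤ rise φ p) : base φ (lower φ α a p) = base φ p - a := by
  rw [base, future_lower hp hα ha har, max_eq_left (by change base φ p - _ ≤ _; linarith)]

theorem wt_lower {p : PathMap V} (hp : HeightBdd φ p) {a : ℝ} (ha : 0 ≤ a)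
    (har : a ≤ rise φ p) : (lower φ α a p).wt = p.wt - a • α := by
  change (lower φ α a p).toFun p.len = _
  rw [lower_toFun, gain_eq hp ha, future_of_len_le p le_rfl, ← rise, min_eq_left har]
  rfl

theorem rise_lower {p : PathMap V} (hp : IsTame φ p) (hα : φ α = 2) {a : ℝ} (ha : 0 ≤ a)
    (har : a ≤ rise φ p) : rise φ (lower φ α a p) = rise φ p - a := by
  rw [rise, base_lower hp hα ha har, wt_lower hp.heightBdd ha har, map_sub, map_smul, hα, rise,
    smul_eq_mul]
  ring

theorem fall_lower {p : PathMap V} (hp : IsTame φ p) (hα : φ α = 2) {a : ℝ} (ha : 0 ≤ a)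
    (har : a ≤ rise φ p) : fall φ (lower φ α a p) = fall φ p + a := by
  rw [fall, base_lower hp hα ha har, fall]; ring

/-- By `future_lower`, the future infimum measured from the minimum, say `x`, becomes `max 0 (x -
a)`; hence the two gains add up to `min (a + b) x`. -/
theorem lower_lower {p : PathMap V} (hp : IsTame φ p) (hα : φ α = 2) {a b : ℝ} (ha : 0 ≤ a)
    (har : a ≤ rise φ p) (hb : 0 ≤ b) :
    lower φ α b (lower φ α a p) = lower φ α (a + b) p := by
  have hp' := hp.heightBdd
  have : ∀ t, gain φ (a + b) p t = gain φ a p t + gain φ b (lower φ α a p) t := by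
    intro t
    rw [gain_eq hp' ha, gain_eq hp' (add_nonneg ha hb), gain_eq (hp'.lower ha hα) hb,
      future_lower hp hα ha har, base_lower hp hα ha har]
    have := base_le_future hp' t
    simp only [min_def, max_def]
    split_ifs <;> linarith
  ext t
  · rfl
  · rw [lower_toFun, lower_toFun, lower_toFun, this]
    module

theorem future_reverse {p : PathMap V} (hp : HeightBdd φ p) (hp' : HeightBdd φ p.reverse)
    (t : ℝ) : future φ p.reverse t = past φ p (p.len - t) - φ p.wt := by
  refine eq_of_forall_le_iff fun c => ?_
  rw [le_future_iff hp', le_sub_iff_add_le, le_past_iff hp]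
  simp only [reverse_toFun, map_sub, le_sub_iff_add_le]
  constructor
  · intro h s hs
    have := h (p.len - s) (by linarith)
    rwa [sub_sub_cancel] at this
  · intro h s hs
    exact h _ (by linarith)

theorem HeightBdd.reverse {p : PathMap V} (hp : HeightBdd φ p) : HeightBdd φ p.reverse := by
  obtain ⟨B, hB⟩ := hp
  refine ⟨B - φ (p.toFun p.len), fun t => ?_⟩
  rw [reverse_toFun, map_sub]
  exact sub_le_sub_right (hB _) _

theorem past_len (p : PathMap V) {t : ℝ} (hp : HeightBdd φ p) (ht : p.len ≤ t) :
    past φ p t = base φ p := by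
  refine eq_of_forall_le_iff fun c => ?_
  rw [le_past_iff hp, le_base_iff hp]
  refine ⟨fun h s => ?_, fun h s _ => h s⟩
  rcases le_total s p.len with h' | h'
  · exact h s (h'.trans ht)
  · rw [p.eq_end_of_ge s h']
    exact h _ ht

theorem base_reverse {p : PathMap V} (hp : HeightBdd φ p) :
    base φ p.reverse = base φ p - φ p.wt := by
  rw [base, future_reverse hp hp.reverse, sub_zero, past_len p hp le_rfl]

theorem rise_reverse {p : PathMap V} (hp : HeightBdd φ p) : rise φ p.reverse = fall φ p := by
  rw [rise, base_reverse hp, wt_reverse, map_neg, fall]; ring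

theorem fall_reverse {p : PathMap V} (hp : HeightBdd φ p) : fall φ p.reverse = rise φ p := by
  rw [fall, base_reverse hp, rise]; ring

theorem past_of_nonpos (p : PathMap V) {t : ℝ} (ht : t ≤ 0) : past φ p t = 0 := by
  unfold past
  have : (fun s => φ (p.toFun s)) '' Set.Iic t = {0} := by
    apply Set.Subset.antisymm
    · rintro _ ⟨s, hs, rfl⟩
      simp [p.eq_zero_of_le s (le_trans hs ht)]
    · rintro _ rfl
      exact ⟨t, Set.self_mem_Iic, by simp [p.eq_zero_of_le t ht]⟩
  rw [this, csInf_singleton]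

theorem raise_toFun {p : PathMap V} (hp : HeightBdd φ p) {a : ℝ} (ha : 0 ≤ a)
    (haf : a ≤ fall φ p) (t : ℝ) :
    (raise φ α a p).toFun t = p.toFun t + (a - min a (past φ p t - base φ p)) • α := by
  have h : ∀ s, gain φ a p.reverse s = min a (past φ p (p.len - s) - base φ p) := by
    intro s
    rw [gain_eq hp.reverse ha, future_reverse hp hp.reverse, base_reverse hp,
      sub_sub_sub_cancel_right]
  rw [raise, reverse_toFun]
  simp only [lower_toFun, reverse_toFun, len_lower, len_reverse, h, sub_self, sub_sub_cancel,
    p.toFun_zero]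
  rw [past_of_nonpos p le_rfl, min_eq_left (a := a) (b := 0 - base φ p) (by unfold fall at haf; linarith)]
  module

/-- The past infimum of the lowered path records how much has been reflected: up to the cap `a`, its
height above the new minimum is `a` minus the gain at time `t`. Raising therefore adds back exactly
what lowering subtracted. -/
theorem raise_lower {p : PathMap V} (hp : IsTame φ p) (hα : φ α = 2) {a : ℝ} (ha : 0 ≤ a)
    (har : a ≤ rise φ p) : raise φ α a (lower φ α a p) = p := by
  have hb := hp.heightBdd
  have hl := hb.lower ha hα
  ext t
  · rfl
  · rw [raise_toFun hl ha (by rw [fall_lower hp hα ha har]; linarith [fall_nonneg hb]),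
      lower_toFun, sub_add, ← sub_smul, gain_eq hb ha, base_lower hp hα ha har]
    suffices h : min a (past φ (lower φ α a p) t - (base φ p - a))
        = a - min a (future φ p t - base φ p) by
      rw [h]; simp
    apply le_antisymm
    · rcases (base_le_future hb t).eq_or_lt with h0 | h0
      · rw [← h0, sub_self, min_eq_right ha, sub_zero]
        exact min_le_left _ _
      rcases ha.eq_or_lt with rfl | ha'
      · exact (min_le_left _ _).trans (sub_nonneg.2 (min_le_left _ _))
      -- At the last passage through this level the lowered path has height `base` minus the gain at
      -- `t`, which bounds the past infimum from above.
      obtain ⟨s, -, hs, h1, h2⟩ := exists_eq_future hp (t₁ := 0)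
        (c := base φ p + min a (future φ p t - base φ p)) (t₂ := t)
        (by change base φ p < _; linarith [lt_min ha' (sub_pos.2 h0)])
        (by linarith [min_le_right a (future φ p t - base φ p)])
      have h3 := past_le hl hs
      rw [height_lower hb hα ha, h1, h2, add_sub_cancel_left,
        min_eq_right (min_le_left a _)] at h3
      exact (min_le_right _ _).trans (by linarith)
    · have hm : 0 ≤ min a (future φ p t - base φ p) :=
        le_min ha (by linarith [base_le_future hb t])
      refine le_min (by linarith) ?_
      suffices base φ p - min a (future φ p t - base φ p) ≤ past φ (lower φ α a p) t by linarith
      refine (le_past_iff hl).2 fun s hs => ?_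
      rw [height_lower hb hα ha]
      have h1 : min a (future φ p s - base φ p) ≤ min a (future φ p t - base φ p) :=
        min_le_min_left _ (by linarith [future_mono hb hs])
      have h2 := future_le hb (le_refl s)
      linarith [min_le_right a (future φ p s - base φ p)]

end Lowering

end PathMap

end

noncomputable section

namespace PathMap

/-- Concatenations of straight segments `t ↦ t μ`, `t ∈ [0, r]`, with `μ ∈ Λ` and `r ∈ S`. -/
inductive Segmented {V : Type*} [AddCommGroup V] [Module ℝ V] (Λ : Set V) (S : Set ℝ≥0) :
    PathMap V → Prop
  | seg (r : ℝ≥0) (hr : r ∈ S) (μ : V) (hμ : μ ∈ Λ) : Segmented Λ S ((line μ).stretch r)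
  | concat (p q : PathMap V) : Segmented Λ S p → Segmented Λ S q → Segmented Λ S (p.concat q)

/-! ### The unit operators, and paths as concatenations of segments. -/

section Operators

variable {V : Type*} [AddCommGroup V] [Module ℝ V] (φ : V →ₗ[ℝ] ℝ) (α : V)

open Classical in
/-- The operator that reflects the first unit of the rise. -/
def lowerOp (p : PathMap V) : Option (PathMap V) :=
  if 1 ≤ rise φ p then some (lower φ α 1 p) else none

/-- The operator that reflects the last unit of the fall. -/
def raiseOp (p : PathMap V) : Option (PathMap V) := (lowerOp φ α p.reverse).map reverse

variable {φ α}

theorem lowerOp_eq_some {p q : PathMap V} :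
    lowerOp φ α p = some q ↔ 1 ≤ rise φ p ∧ lower φ α 1 p = q := by
  unfold lowerOp
  split_ifs with h <;> simp [h]

theorem lowerOp_eq_none {p : PathMap V} : lowerOp φ α p = none ↔ rise φ p < 1 := by
  unfold lowerOp
  split_ifs with h <;> simp [h]
  simpa using h

theorem lowerOp_of_le {p : PathMap V} (h : 1 ≤ rise φ p) :
    lowerOp φ α p = some (lower φ α 1 p) := if_pos h

/-- Outside the open unit interval the share of `p` in `lower_concat` is 1 or 0, so the whole unit
is reflected in a single factor. -/
theorem lowerOp_concat {p q : PathMap V} (hp : HeightBdd φ p) (hq : HeightBdd φ q)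
    (h : rise φ p - fall φ q ∉ Set.Ioo (0 : ℝ) 1) :
    (fall φ q < rise φ p → lowerOp φ α (p.concat q) = (lowerOp φ α p).map (·.concat q)) ∧
    (rise φ p ≤ fall φ q → lowerOp φ α (p.concat q) = (lowerOp φ α q).map p.concat) := by
  constructor
  · intro hlt
    have h1 : 1 ≤ rise φ p - fall φ q := by
      by_contra hc
      exact h ⟨sub_pos.2 hlt, not_le.1 hc⟩
    have h2 := fall_nonneg hq
    have h3 := rise_nonneg hq
    rw [lowerOp_of_le (by rw [rise_concat hp hq]; linarith [le_max_right 0 (rise φ p - fall φ q)]),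
      lowerOp_of_le (p := p) (by linarith), Option.map_some,
      lower_concat hp hq (b := 1) zero_le_one (by
        rw [max_eq_right (by linarith), min_eq_left h1]), sub_self, lower_zero]
  · intro hle
    have hr : rise φ (p.concat q) = rise φ q := by
      rw [rise_concat hp hq, max_eq_left (by linarith), add_zero]
    unfold lowerOp
    rw [hr]
    split_ifs
    · rw [Option.map_some, lower_concat hp hq (b := 0) zero_le_one (by
        rw [max_eq_left (by linarith), min_eq_right zero_le_one]), lower_zero, sub_zero]
    · rfl

theorem raiseOp_concat {p q : PathMap V} (hp : HeightBdd φ p) (hq : HeightBdd φ q)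
    (h : fall φ q - rise φ p ∉ Set.Ioo (0 : ℝ) 1) :
    (fall φ q ≤ rise φ p → raiseOp φ α (p.concat q) = (raiseOp φ α p).map (·.concat q)) ∧
    (rise φ p < fall φ q → raiseOp φ α (p.concat q) = (raiseOp φ α q).map p.concat) := by
  have key := lowerOp_concat (α := α) hq.reverse hp.reverse
    (by rwa [rise_reverse hq, fall_reverse hp])
  rw [rise_reverse hq, fall_reverse hp] at key
  unfold raiseOp
  rw [reverse_concat]
  constructor
  · intro hle
    rw [key.2 hle, Option.map_map, Option.map_map]
    congr 1
    funext x
    simp [reverse_concat]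
  · intro hlt
    rw [key.1 hlt, Option.map_map, Option.map_map]
    congr 1
    funext x
    simp [reverse_concat]

theorem raiseOp_reverse (p : PathMap V) :
    raiseOp φ α p.reverse = (lowerOp φ α p).map reverse := by
  rw [raiseOp, reverse_reverse]

theorem lowerOp_reverse (p : PathMap V) :
    lowerOp φ α p.reverse = (raiseOp φ α p).map reverse := by
  rw [raiseOp, Option.map_map]
  have : (reverse ∘ reverse : PathMap V → PathMap V) = id := funext reverse_reverse
  rw [this, Option.map_id, id]

theorem raiseOp_eq_some {p q : PathMap V} (hp : HeightBdd φ p) :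
    raiseOp φ α p = some q ↔ 1 ≤ fall φ p ∧ raise φ α 1 p = q := by
  rw [raiseOp, Option.map_eq_some_iff]
  simp only [lowerOp_eq_some, rise_reverse hp, raise]
  constructor
  · rintro ⟨_, ⟨h, rfl⟩, h'⟩; exact ⟨h, h'⟩
  · rintro ⟨h, h'⟩; exact ⟨_, ⟨h, rfl⟩, h'⟩

theorem raiseOp_eq_none {p : PathMap V} (hp : HeightBdd φ p) :
    raiseOp φ α p = none ↔ fall φ p < 1 := by
  rw [raiseOp, Option.map_eq_none_iff, lowerOp_eq_none, rise_reverse hp]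

theorem power_conj {X : Type*} {f g : X → Option X} {σ : X → X} (hσ : Function.Involutive σ)
    (h : ∀ x, g x = (f (σ x)).map σ) (n : ℕ) (x : X) :
    power g n x = (power f n (σ x)).map σ := by
  induction n with
  | zero => simp [power, hσ x]
  | succ n ih =>
    simp only [power, ih]
    cases power f n (σ x) with
    | none => rfl
    | some y => simp [h, hσ y]

theorem power_raiseOp (n : ℕ) (p : PathMap V) :
    power (raiseOp φ α) n p = (power (lowerOp φ α) n p.reverse).map reverse :=
  power_conj reverse_reverse (fun _ => rfl) n p

theorem base_line (μ : V) (hb : HeightBdd φ (line μ)) : base φ (line μ) = min 0 (φ μ) := by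
  refine eq_of_forall_le_iff fun c => ?_
  rw [le_base_iff hb, le_min_iff]
  simp only [line_toFun, map_smul, smul_eq_mul]
  constructor
  · intro h
    have h0 := h 0
    have h1 := h 1
    norm_num at h0 h1
    exact ⟨h0, h1⟩
  · rintro ⟨h0, h1⟩ s
    have h2 : (0 : ℝ) ≤ max 0 (min s 1) := le_max_left _ _
    have h3 : max 0 (min s 1) ≤ 1 := max_le zero_le_one (min_le_right _ _)
    rcases le_total 0 (φ μ) with h | h
    · exact h0.trans (mul_nonneg h2 h)
    · nlinarith

theorem isTame_stretch_line (r : ℝ≥0) (μ : V) : IsTame φ ((line μ).stretch r) := by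
  refine ⟨‖φ μ‖₊ * 1, ?_⟩
  have h1 : LipschitzWith 1 (fun t : ℝ => max 0 (min t (r : ℝ))) :=
    (LipschitzWith.id.min_const _).const_max _
  have h2 := (lipschitzWith_smul (α := ℝ) (β := ℝ) (φ μ)).comp h1
  have h3 : (fun t => φ (((line μ).stretch r).toFun t))
      = (fun x : ℝ => φ μ • x) ∘ fun t : ℝ => max 0 (min t (r : ℝ)) := by
    funext t
    simp [stretch_line_toFun, mul_comm]
  rw [h3]
  exact h2

theorem IsTame.concat {p q : PathMap V} (hp : IsTame φ p) (hq : IsTame φ q) :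
    IsTame φ (p.concat q) := by
  obtain ⟨C, hC⟩ := hp
  obtain ⟨D, hD⟩ := hq
  have h1 : LipschitzWith 1 (fun t : ℝ => t - p.len) :=
    LipschitzWith.of_dist_le_mul fun x y => by simp [Real.dist_eq]
  refine ⟨C + D * 1, ?_⟩
  have h2 : (fun t => φ ((p.concat q).toFun t))
      = fun t => φ (p.toFun t) + ((fun t => φ (q.toFun t)) ∘ fun t : ℝ => t - p.len) t := by
    funext t
    simp [concat_toFun]
  rw [h2]
  exact hC.add (hD.comp h1)

theorem Segmented.isTame {Λ : Set V} {S : Set ℝ≥0} {p : PathMap V} (h : Segmented Λ S p) :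
    IsTame φ p := by
  induction h with
  | seg r hr μ hμ => exact isTame_stretch_line r μ
  | concat p q _ _ hp hq => exact hp.concat hq

theorem Segmented.generated {Λ : Set V} {S : Set ℝ≥0} {p : PathMap V} (h : Segmented Λ S p) :
    Generated Λ S p := by
  induction h with
  | seg r hr μ hμ => exact .stretch r hr _ (.line μ hμ)
  | concat p q _ _ hp hq => exact .concat p q hp hq

/-- Reversal and stretching distribute over concatenation and send segments to segments. This normal
form allows inductions over segments and concatenations only. -/
theorem Generated.segmented {Λ : Set V} (hΛ : ∀ μ ∈ Λ, -μ ∈ Λ) {p : PathMap V}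
    (h : Generated Λ Set.univ p) : Segmented Λ Set.univ p := by
  induction h with
  | line μ hμ => simpa using Segmented.seg (S := Set.univ) 1 (Set.mem_univ _) μ hμ
  | concat p q _ _ hp hq => exact .concat p q hp hq
  | reverse p _ hp =>
    clear * - hp hΛ
    induction hp with
    | seg r hr μ hμ => rw [reverse_stretch, reverse_line]; exact .seg r hr _ (hΛ μ hμ)
    | concat p q _ _ hp hq => rw [reverse_concat]; exact .concat _ _ hq hp
  | stretch r _ p _ hp =>
    clear * - hp
    induction hp with
    | seg s hr μ hμ => rw [stretch_stretch]; exact .seg _ (Set.mem_univ _) _ hμ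
    | concat p q _ _ hp hq => rw [stretch_concat]; exact .concat _ _ hp hq

theorem rise_stretch_line (r : ℝ≥0) (μ : V) :
    rise φ ((line μ).stretch r) = r * max 0 (φ μ) := by
  have hb : HeightBdd φ (line μ) := by simpa using (isTame_stretch_line (φ := φ) 1 μ).heightBdd
  rw [rise_stretch hb, rise, wt_line, base_line μ hb]
  congr 1
  rcases le_total 0 (φ μ) with h | h <;> simp [h]

theorem fall_stretch_line (r : ℝ≥0) (μ : V) :
    fall φ ((line μ).stretch r) = r * max 0 (-φ μ) := by
  have hb : HeightBdd φ (line μ) := by simpa using (isTame_stretch_line (φ := φ) 1 μ).heightBdd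
  rw [fall_stretch hb, fall, base_line μ hb]
  congr 1
  rcases le_total 0 (φ μ) with h | h <;> simp [h]

theorem lower_of_rise_eq_zero {p : PathMap V} (hp : HeightBdd φ p) (h : rise φ p = 0) (a : ℝ) :
    lower φ α a p = p := by
  ext t
  · rfl
  · have h1 := base_le_future hp t
    have h2 := future_le_wt hp t
    have h3 : future φ p t - base φ p = 0 := by unfold rise at h; linarith
    rw [lower_toFun, gain, h3, max_eq_left (min_le_right _ _), zero_smul, sub_zero]

/-- On a rising segment the future infimum is the height itself, so an amount covering the total
height reflects the whole segment. -/
theorem lower_stretch_line {r : ℝ≥0} {μ : V} (hμ : 0 ≤ φ μ) {a : ℝ} (ha : r * φ μ ≤ a) :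
    lower φ α a ((line μ).stretch r) = (line (μ - φ μ • α)).stretch r := by
  have hb := (isTame_stretch_line (φ := φ) r μ).heightBdd
  have hr := r.coe_nonneg
  have h0 : base φ ((line μ).stretch r) = 0 := by
    have := fall_stretch_line (φ := φ) r μ
    rw [max_eq_left (by linarith), mul_zero, fall] at this
    linarith
  have hfut : ∀ t, future φ ((line μ).stretch r) t = max 0 (min t r) * φ μ := by
    intro t
    apply le_antisymm
    · have := future_le hb (le_refl t)
      rwa [stretch_line_toFun, map_smul, smul_eq_mul] at this
    · refine (le_future_iff hb).2 fun s hs => ?_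
      rw [stretch_line_toFun, map_smul, smul_eq_mul]
      exact mul_le_mul_of_nonneg_right (max_le_max_left _ (min_le_min_right _ hs)) hμ
  ext t
  · rfl
  · have h2 : (0 : ℝ) ≤ max 0 (min t r) := le_max_left _ _
    have h3 : max 0 (min t r) ≤ (r : ℝ) := max_le hr (min_le_right _ _)
    rw [lower_toFun, gain, hfut, h0, sub_zero, stretch_line_toFun, stretch_line_toFun,
      min_eq_right ((mul_le_mul_of_nonneg_right h3 hμ).trans ha), max_eq_right (mul_nonneg h2 hμ)]
    module

end Operators

/-- A reflection `μ ↦ μ - φ μ • α` that preserves a symmetric set `Λ` of vectors. -/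
structure ReflectionDatum (V : Type*) [AddCommGroup V] [Module ℝ V] where
  φ : V →ₗ[ℝ] ℝ
  α : V
  Λ : Set V
  apply_root : φ α = 2
  neg_mem : ∀ μ ∈ Λ, -μ ∈ Λ
  reflect_mem : ∀ μ ∈ Λ, μ - φ μ • α ∈ Λ

/-! ### Existence: the operators of a reflection on the generated paths. -/

namespace ReflectionDatum

variable {V : Type*} [AddCommGroup V] [Module ℝ V] (T : ReflectionDatum V)

/-- The paths generated by the lines in the directions of `Λ`. -/
def paths : Set (PathMap V) := {p | Generated T.Λ Set.univ p}

/-- The lowering operator of a reflection datum. -/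
abbrev f : PathMap V → Option (PathMap V) := lowerOp T.φ T.α

/-- The raising operator of a reflection datum. -/
abbrev e : PathMap V → Option (PathMap V) := raiseOp T.φ T.α

variable {T} {p q : PathMap V}

theorem segmented (hp : p ∈ T.paths) : Segmented T.Λ Set.univ p := Generated.segmented T.neg_mem hp

theorem tame (hp : p ∈ T.paths) : IsTame T.φ p := (segmented hp).isTame

theorem bdd (hp : p ∈ T.paths) : HeightBdd T.φ p := (tame hp).heightBdd

theorem reverse_mem (hp : p ∈ T.paths) : p.reverse ∈ T.paths := Generated.reverse p hp

theorem concat_mem (hp : p ∈ T.paths) (hq : q ∈ T.paths) : p.concat q ∈ T.paths :=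
  Generated.concat p q hp hq

theorem stretch_mem (hp : p ∈ T.paths) (r : ℝ≥0) : p.stretch r ∈ T.paths :=
  Generated.stretch r (Set.mem_univ _) p hp

theorem line_mem {μ : V} (hμ : μ ∈ T.Λ) : line μ ∈ T.paths := Generated.line μ hμ

/-- The induction needs all real amounts at once, since a concatenation divides `a` into arbitrary
real shares. -/
theorem lower_mem (hp : p ∈ T.paths) {a : ℝ} (ha : 0 ≤ a) : lower T.φ T.α a p ∈ T.paths := by
  have h := segmented hp
  clear hp
  induction h generalizing a with
  | seg r hr μ hμ =>
    have hs : ∀ (s : ℝ≥0) (ν : V), ν ∈ T.Λ → (line ν).stretch s ∈ T.paths := fun s ν hν =>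
      stretch_mem (line_mem hν) s
    rcases le_or_gt (T.φ μ) 0 with h | h
    · rw [lower_of_rise_eq_zero (isTame_stretch_line r μ).heightBdd
        (by rw [rise_stretch_line, max_eq_left h, mul_zero])]
      exact hs r μ hμ
    rcases le_total (r * T.φ μ) a with h' | h'
    · rw [lower_stretch_line h.le h']
      exact hs r _ (T.reflect_mem μ hμ)
    · have hq : 0 ≤ a / T.φ μ := div_nonneg ha h.le
      have hqr : a / T.φ μ ≤ r := (div_le_iff₀ h).2 h'
      -- The segment is cut where its height reaches `a`; only the first piece is reflected.
      obtain ⟨s, hs'⟩ : ∃ s : ℝ≥0, (s : ℝ) = a / T.φ μ := ⟨⟨_, hq⟩, rfl⟩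
      have hsr : s ≤ r := by rw [← NNReal.coe_le_coe, hs']; exact hqr
      have hsa : s * T.φ μ = a := by rw [hs', div_mul_cancel₀ _ h.ne']
      rw [← add_tsub_cancel_of_le hsr, stretch_add_line,
        lower_concat (b := a) (isTame_stretch_line s μ).heightBdd
          (isTame_stretch_line _ μ).heightBdd ha (by
          rw [rise_stretch_line, fall_stretch_line, max_eq_right h.le, hsa,
            max_eq_left (a := 0) (b := -T.φ μ) (by linarith), mul_zero, sub_zero, max_eq_right ha, min_self]),
        sub_self, lower_zero, lower_stretch_line h.le hsa.le]
      exact concat_mem (hs s _ (T.reflect_mem μ hμ)) (hs _ μ hμ)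
  | concat p q hp hq ihp ihq =>
    rw [lower_concat hp.isTame.heightBdd hq.isTame.heightBdd ha rfl]
    exact concat_mem (ihp (le_min ha (le_max_left _ _))) (ihq (sub_nonneg.2 (min_le_left _ _)))

theorem f_mem (hp : p ∈ T.paths) (h : T.f p = some q) : q ∈ T.paths := by
  rw [← (lowerOp_eq_some.1 h).2]
  exact lower_mem hp zero_le_one

theorem e_mem (hp : p ∈ T.paths) (h : T.e p = some q) : q ∈ T.paths := by
  rw [e, raiseOp, Option.map_eq_some_iff] at h
  obtain ⟨x, hx, rfl⟩ := h
  exact reverse_mem (f_mem (reverse_mem hp) hx)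

theorem e_f (hp : p ∈ T.paths) (h : T.f p = some q) : T.e q = some p := by
  have hq := f_mem hp h
  obtain ⟨h1, rfl⟩ := lowerOp_eq_some.1 h
  refine (raiseOp_eq_some (bdd hq)).2 ⟨?_, raise_lower (tame hp) T.apply_root zero_le_one h1⟩
  rw [fall_lower (tame hp) T.apply_root zero_le_one h1]
  linarith [fall_nonneg (bdd hp)]

theorem f_e (hp : p ∈ T.paths) (h : T.e p = some q) : T.f q = some p := by
  rw [e, raiseOp, Option.map_eq_some_iff] at h
  obtain ⟨x, hx, rfl⟩ := h
  have := e_f (reverse_mem hp) hx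
  exact (lowerOp_reverse x).trans ((congrArg (Option.map reverse) this).trans (by simp))

theorem wt_f (hp : p ∈ T.paths) (h : T.f p = some q) : q.wt = p.wt - T.α := by
  obtain ⟨h1, rfl⟩ := lowerOp_eq_some.1 h
  rw [wt_lower (bdd hp) zero_le_one h1, one_smul]

theorem wt_e (hp : p ∈ T.paths) (h : T.e p = some q) : q.wt = p.wt + T.α := by
  rw [wt_f (e_mem hp h) (f_e hp h), sub_add_cancel]

/-- Additivity turns `n` unit steps into a single lowering by `n`; each step uses up one unit of
rise. -/
theorem power_f (hp : p ∈ T.paths) (n : ℕ) : power T.f n p =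
    if (n : ℝ) ≤ rise T.φ p then some (lower T.φ T.α n p) else none := by
  have ht := tame hp
  induction n with
  | zero => simp [power, lower_zero, rise_nonneg (bdd hp)]
  | succ n ih =>
    have hn : (0 : ℝ) ≤ n := n.cast_nonneg
    rw [power, ih]
    push_cast
    split_ifs with h1 h2 h2
    · rw [Option.bind_some, f, lowerOp_of_le, lower_lower ht T.apply_root hn h1 zero_le_one]
      rw [rise_lower ht T.apply_root hn h1]
      linarith
    · rw [Option.bind_some, f, lowerOp_eq_none, rise_lower ht T.apply_root hn h1]
      linarith
    · linarith
    · rfl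

theorem power_f_stretch (hp : p ∈ T.paths) (r : ℕ) (h : 0 < r ∨ T.f p ≠ none) :
    power T.f r (p.stretch r) = (T.f p).map (stretch r) := by
  rw [power_f (stretch_mem hp _), rise_stretch (bdd hp)]
  rcases r.eq_zero_or_pos with rfl | hr
  -- The zeroth power never vanishes, so `r = 0` requires `f p ≠ 0`; both sides are then the path of
  -- length zero.
  · obtain ⟨x, hx⟩ := Option.ne_none_iff_exists'.1 (h.resolve_left (lt_irrefl 0))
    rw [hx]
    simp [lower_zero, stretch_zero]
  · have hr' : (0 : ℝ) < r := Nat.cast_pos.2 hr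
    have : ((r : ℝ) ≤ ((r : ℝ≥0) : ℝ) * rise T.φ p) ↔ 1 ≤ rise T.φ p := by
      rw [NNReal.coe_natCast, le_mul_iff_one_le_right hr']
    rw [f, lowerOp]
    simp only [this]
    split_ifs
    · have := lower_stretch (α := T.α) (bdd hp) r 1
      rw [mul_one, NNReal.coe_natCast] at this
      rw [this, Option.map_some]
    · rfl

theorem power_e_stretch (hp : p ∈ T.paths) (r : ℕ) (h : 0 < r ∨ T.e p ≠ none) :
    power T.e r (p.stretch r) = (T.e p).map (stretch r) := by
  rw [e, power_raiseOp, reverse_stretch, power_f_stretch (reverse_mem hp) r, raiseOp,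
    Option.map_map, Option.map_map]
  · congr 1
    funext x
    simp [reverse_stretch]
  · refine h.imp_right fun h' h0 => h' ?_
    exact (congrArg (Option.map reverse) h0).trans rfl

theorem power_f_line {μ : V} (hμ : μ ∈ T.Λ) {n : ℕ} (h : T.φ μ = n) :
    power T.f n (line μ) = some (line (μ - T.φ μ • T.α)) := by
  have hn : (0 : ℝ) ≤ n := n.cast_nonneg
  have h1 := rise_stretch_line (φ := T.φ) 1 μ
  have h2 := lower_stretch_line (φ := T.φ) (α := T.α) (r := 1) (μ := μ) (a := n) (by rw [h]; exact hn)
    (by simp [h])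
  simp only [stretch_one] at h1 h2
  rw [power_f (line_mem hμ), h1, h2, if_pos]
  simp [h]

/-- A path can be cut at a minimum of its height. -/
theorem exists_split (hp : p ∈ T.paths) : ∃ p₁ ∈ T.paths, ∃ p₂ ∈ T.paths,
    p = p₁.concat p₂ ∧ rise T.φ p₁ = 0 ∧ fall T.φ p₂ = 0 := by
  have h := segmented hp
  clear hp
  induction h with
  | seg r hr μ hμ =>
    have h0 : (line μ).stretch 0 ∈ T.paths := stretch_mem (line_mem hμ) 0
    have h1 : (line μ).stretch r ∈ T.paths := stretch_mem (line_mem hμ) r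
    rcases le_total (T.φ μ) 0 with h | h
    · exact ⟨_, h1, _, h0, by rw [stretch_zero, concat_trivial],
        by rw [rise_stretch_line, max_eq_left h, mul_zero], by rw [fall_stretch_line]; simp⟩
    · exact ⟨_, h0, _, h1, by rw [stretch_zero, trivial_concat],
        by rw [rise_stretch_line]; simp,
        by rw [fall_stretch_line, max_eq_left (by linarith), mul_zero]⟩
  | concat p q _ _ ihp ihq =>
    obtain ⟨a₁, ha₁, a₂, ha₂, rfl, h1, h2⟩ := ihp
    obtain ⟨b₁, hb₁, b₂, hb₂, rfl, h3, h4⟩ := ihq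
    -- The middle part `a₂ ⊗ b₁` goes up and then down; its net change decides whether the minimum
    -- lies after it or before it.
    rcases le_total (rise T.φ a₂) (fall T.φ b₁) with h | h
    · refine ⟨_, concat_mem ha₁ (concat_mem ha₂ hb₁), b₂, hb₂, by simp only [concat_assoc], ?_, h4⟩
      have h5 : rise T.φ (a₂.concat b₁) = 0 := by
        rw [rise_concat (bdd ha₂) (bdd hb₁), h3, max_eq_left (by linarith), add_zero]
      rw [rise_concat (bdd ha₁) (bdd (concat_mem ha₂ hb₁)), h5, h1,
        max_eq_left (by linarith [fall_nonneg (bdd (concat_mem ha₂ hb₁))]), add_zero]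
    · refine ⟨a₁, ha₁, _, concat_mem (concat_mem ha₂ hb₁) hb₂, by simp only [concat_assoc], h1, ?_⟩
      have h5 : fall T.φ (a₂.concat b₁) = 0 := by
        rw [fall_concat (bdd ha₂) (bdd hb₁), h2, max_eq_left (by linarith), add_zero]
      rw [fall_concat (bdd (concat_mem ha₂ hb₁)) (bdd hb₂), h5, h4,
        max_eq_left (by linarith [rise_nonneg (bdd (concat_mem ha₂ hb₁))]), add_zero]

end ReflectionDatum

end PathMap

end

noncomputable section

open Filter Topology

namespace PathMap

/-! ### Continuity of the path operations. -/

section Convergence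

variable {V : Type*} [AddCommGroup V] [Module ℝ V] {φ : V →ₗ[ℝ] ℝ} {α : V}
  {p q : ℕ → PathMap V} {p₀ q₀ : PathMap V}

/-- Concatenation and reversal shift time by lengths that vary with `n`; a Lipschitz limit absorbs
this reparametrization. -/
theorem tendstoUniformly_comp_of_lipschitz {F : ℕ → ℝ → ℝ} {G : ℝ → ℝ} {C : ℝ≥0}
    (hF : TendstoUniformly F G atTop) (hG : LipschitzWith C G) {σ : ℕ → ℝ → ℝ} {τ : ℝ → ℝ}
    (hσ : TendstoUniformly σ τ atTop) :
    TendstoUniformly (fun n t => F n (σ n t)) (fun t => G (τ t)) atTop := by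
  have h1 := hG.uniformContinuous.comp_tendstoUniformly hσ
  rw [Metric.tendstoUniformly_iff] at hF h1 ⊢
  intro ε hε
  filter_upwards [hF (ε / 2) (half_pos hε), h1 (ε / 2) (half_pos hε)] with n h2 h3 t
  calc dist (G (τ t)) (F n (σ n t))
      ≤ dist (G (τ t)) (G (σ n t)) + dist (G (σ n t)) (F n (σ n t)) := dist_triangle _ _ _
    _ < ε / 2 + ε / 2 := add_lt_add (h3 t) (h2 _)
    _ = ε := add_halves ε

theorem tendstoUniformly_const_fun {x : ℕ → ℝ} {y : ℝ} (h : Tendsto x atTop (𝓝 y)) :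
    TendstoUniformly (fun n (_ : ℝ) => x n) (fun _ => y) atTop := by
  rw [Metric.tendstoUniformly_iff]
  intro ε hε
  filter_upwards [Metric.tendsto_nhds.1 h ε hε] with n hn t
  rw [dist_comm]
  exact hn

theorem tendstoUniformly_of_dist_le {F : ℕ → ℝ → ℝ} {G : ℝ → ℝ} {u : ℕ → ℝ}
    (hu : Tendsto u atTop (𝓝 0)) (h : ∀ n t, dist (G t) (F n t) ≤ u n) :
    TendstoUniformly F G atTop := by
  rw [Metric.tendstoUniformly_iff]
  intro ε hε
  filter_upwards [hu.eventually_lt_const hε] with n hn t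
  exact (h n t).trans_lt hn

theorem tendstoUniformly_add_const {x : ℕ → ℝ} {y : ℝ} (h : Tendsto x atTop (𝓝 y))
    (g : ℝ → ℝ) : TendstoUniformly (fun n t => g t + x n) (fun t => g t + y) atTop := by
  refine tendstoUniformly_of_dist_le (u := fun n => dist y (x n)) ?_ fun n t => by
    rw [dist_add_left]
  simpa using (tendsto_const_nhds (x := y)).dist h

theorem Converges.concat (hp : Converges p p₀) (hq : Converges q q₀)
    (h : ∀ ψ : V →ₗ[ℝ] ℝ, IsTame ψ q₀) :
    Converges (fun n => (p n).concat (q n)) (p₀.concat q₀) := by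
  refine ⟨hp.1.add hq.1, fun ψ => ?_⟩
  obtain ⟨C, hC⟩ := h ψ
  have h1 := tendstoUniformly_comp_of_lipschitz (hq.2 ψ) hC
    (tendstoUniformly_add_const hp.1.neg id)
  have h2 := (hp.2 ψ).add h1
  simp only [concat_toFun, map_add, sub_eq_add_neg]
  exact h2

theorem Converges.tendsto (hp : Converges p p₀) (ψ : V →ₗ[ℝ] ℝ) (t : ℝ) :
    Tendsto (fun n => ψ ((p n).toFun t)) atTop (𝓝 (ψ (p₀.toFun t))) :=
  (hp.2 ψ).tendsto_at t

theorem Converges.tendsto_wt (hp : Converges p p₀) (ψ : V →ₗ[ℝ] ℝ) :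
    Tendsto (fun n => ψ (p n).wt) atTop (𝓝 (ψ p₀.wt)) := by
  -- At this time all but finitely many of the paths have already ended.
  have h := hp.tendsto ψ (p₀.len + 1)
  rw [p₀.eq_end_of_ge _ (by linarith)] at h
  refine h.congr' ?_
  filter_upwards [hp.1.eventually_le_const (lt_add_one p₀.len)] with n hn
  rw [(p n).eq_end_of_ge _ hn]
  rfl

theorem Converges.reverse (hp : Converges p p₀) (h : ∀ ψ : V →ₗ[ℝ] ℝ, IsTame ψ p₀) :
    Converges (fun n => (p n).reverse) p₀.reverse := by
  refine ⟨hp.1, fun ψ => ?_⟩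
  obtain ⟨C, hC⟩ := h ψ
  have h1 := tendstoUniformly_comp_of_lipschitz (hp.2 ψ) hC
    (tendstoUniformly_add_const hp.1 fun t => -t)
  have h2 := h1.sub (tendstoUniformly_const_fun (hp.tendsto_wt ψ))
  simp only [reverse_toFun, map_sub, sub_eq_neg_add _ (_ : ℝ)]
  simp only [sub_eq_neg_add] at h2
  exact h2

theorem Converges.unique (hp : Converges p p₀) (hq : Converges p q₀) : p₀ = q₀ := by
  ext t
  · exact tendsto_nhds_unique hp.1 hq.1
  · rw [← sub_eq_zero, ← Module.forall_dual_apply_eq_zero_iff ℝ]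
    intro ψ
    rw [map_sub, sub_eq_zero]
    exact tendsto_nhds_unique (hp.tendsto ψ t) (hq.tendsto ψ t)

theorem future_le_add {p q : PathMap V} (hp : HeightBdd φ p) (hq : HeightBdd φ q) {δ : ℝ}
    (h : ∀ s, dist (φ (p.toFun s)) (φ (q.toFun s)) ≤ δ) (t : ℝ) :
    future φ p t - δ ≤ future φ q t := by
  refine (le_future_iff hq).2 fun s hs => ?_
  have h1 := abs_le.1 (h s)
  linarith [future_le hp hs]

theorem abs_future_sub_le {p q : PathMap V} (hp : HeightBdd φ p) (hq : HeightBdd φ q) {δ : ℝ}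
    (h : ∀ s, dist (φ (p.toFun s)) (φ (q.toFun s)) ≤ δ) (t : ℝ) :
    |future φ p t - future φ q t| ≤ δ := by
  have h1 := future_le_add hp hq h t
  have h2 := future_le_add hq hp (fun s => by rw [dist_comm]; exact h s) t
  exact abs_le.2 ⟨by linarith, by linarith⟩

theorem Converges.tendstoUniformly_future (hp : Converges p p₀) (h : ∀ n, HeightBdd φ (p n))
    (h₀ : HeightBdd φ p₀) :
    TendstoUniformly (fun n => future φ (p n)) (future φ p₀) atTop := by
  have h1 := hp.2 φ
  rw [Metric.tendstoUniformly_iff] at h1 ⊢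
  intro ε hε
  filter_upwards [h1 (ε / 2) (half_pos hε)] with n hn t
  exact (abs_future_sub_le h₀ (h n) (fun s => (hn s).le) t).trans_lt (half_lt_self hε)

theorem Converges.tendsto_rise (hp : Converges p p₀) (h : ∀ n, HeightBdd φ (p n))
    (h₀ : HeightBdd φ p₀) : Tendsto (fun n => rise φ (p n)) atTop (𝓝 (rise φ p₀)) :=
  (hp.tendsto_wt φ).sub ((hp.tendstoUniformly_future h h₀).tendsto_at 0)

/-- Taking future infima is 1-Lipschitz in the uniform norm, and truncation is uniformly continuous.
-/
theorem Converges.lower (hp : Converges p p₀) (h : ∀ n, HeightBdd φ (p n))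
    (h₀ : HeightBdd φ p₀) (a : ℝ) :
    Converges (fun n => lower φ α a (p n)) (lower φ α a p₀) := by
  refine ⟨hp.1, fun ψ => ?_⟩
  have h1 := hp.tendstoUniformly_future h h₀
  have h2 := h1.sub (tendstoUniformly_const_fun (h1.tendsto_at 0))
  have hu : UniformContinuous fun x : ℝ => max 0 (min a x) * ψ α :=
    ((LipschitzWith.id.const_min a).const_max 0).uniformContinuous.mul_const' (ψ α)
  have h3 := (hp.2 ψ).sub (hu.comp_tendstoUniformly h2)
  simp only [lower_toFun, map_sub, map_smul, smul_eq_mul]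
  exact h3

theorem converges_stretch_line {r : ℕ → ℝ≥0} {s : ℝ≥0} (h : Tendsto r atTop (𝓝 s)) (μ : V) :
    Converges (fun n => (line μ).stretch (r n)) ((line μ).stretch s) := by
  have h' : Tendsto (fun n => (r n : ℝ)) atTop (𝓝 s) := NNReal.tendsto_coe.2 h
  refine ⟨by simpa using h', fun ψ => ?_⟩
  refine tendstoUniformly_of_dist_le (u := fun n => dist (s : ℝ) (r n) * |ψ μ|) ?_ fun n t => ?_
  · simpa using ((tendsto_const_nhds (x := (s : ℝ))).dist h').mul_const |ψ μ|
  · simp only [stretch_line_toFun, map_smul, smul_eq_mul, Real.dist_eq, ← sub_mul, abs_mul]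
    refine mul_le_mul_of_nonneg_right ?_ (abs_nonneg _)
    simpa [Real.dist_eq] using
      ((LipschitzWith.id.const_min t).const_max 0).dist_le_mul (s : ℝ) (r n)

end Convergence

/-! ### Closed graphs. -/

namespace ReflectionDatum

variable {V : Type*} [AddCommGroup V] [Module ℝ V] (T : ReflectionDatum V)

theorem hasClosedGraph_f : HasClosedGraph T.paths T.f := by
  intro p x p₀ x₀ hp hx hp₀ hx₀ hf hpc hxc
  have h := fun n => lowerOp_eq_some.1 (hf n)
  have hb := fun n => bdd (hp n)
  rw [f, lowerOp_of_le (ge_of_tendsto' (hpc.tendsto_rise hb (bdd hp₀)) fun n => (h n).1)]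
  have h1 := hpc.lower (α := T.α) hb (bdd hp₀) 1
  simp only [fun n => (h n).2] at h1
  rw [h1.unique hxc]

theorem hasClosedGraph_e : HasClosedGraph T.paths T.e := by
  intro p x p₀ x₀ hp hx hp₀ hx₀ he hpc hxc
  have h := hasClosedGraph_f T (fun n => (p n).reverse) (fun n => (x n).reverse) p₀.reverse
    x₀.reverse (fun n => reverse_mem (hp n)) (fun n => reverse_mem (hx n)) (reverse_mem hp₀)
    (reverse_mem hx₀) (fun n => ?_) (hpc.reverse fun _ => (segmented hp₀).isTame)
    (hxc.reverse fun _ => (segmented hx₀).isTame)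
  · exact (congrArg (Option.map reverse) h).trans (by simp)
  · exact (lowerOp_reverse _).trans ((congrArg (Option.map reverse) (he n)).trans rfl)

end ReflectionDatum

end PathMap

end

noncomputable section

namespace PathMap

/-! ### Identification of the rank one operators. -/

section RankOne

theorem toFun_clamp {V : Type*} [AddCommGroup V] (p : PathMap V) (t : ℝ) :
    p.toFun (max 0 (min t p.len)) = p.toFun t := by
  change (ofFun p.len p.len_nonneg p.toFun p.toFun_zero).toFun t = _
  exact ofFun_toFun_of_const _ _ p.eq_zero_of_le p.eq_end_of_ge t

theorem clamp_mem {V : Type*} [AddCommGroup V] (p : PathMap V) (t : ℝ) :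
    0 ≤ max 0 (min t p.len) ∧ max 0 (min t p.len) ≤ p.len :=
  ⟨le_max_left _ _, max_le p.len_nonneg (min_le_right _ _)⟩

theorem minOn_eq_future (h : PathMap ℝ) {t : ℝ} (ht : t ≤ h.len) :
    h.minOn t h.len = future LinearMap.id h t := by
  unfold minOn future
  congr 1
  apply Set.Subset.antisymm
  · rintro _ ⟨s, hs, rfl⟩
    exact ⟨s, hs.1, rfl⟩
  · rintro _ ⟨s, hs, rfl⟩
    rcases le_total s h.len with h' | h'
    · exact ⟨s, ⟨hs, h'⟩, rfl⟩
    · exact ⟨h.len, ⟨ht, le_rfl⟩, (h.eq_end_of_ge s h').symm⟩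

theorem minOn_eq_past (h : PathMap ℝ) {t : ℝ} (ht : 0 ≤ t) :
    h.minOn 0 t = past LinearMap.id h t := by
  unfold minOn past
  congr 1
  apply Set.Subset.antisymm
  · rintro _ ⟨s, hs, rfl⟩
    exact ⟨s, hs.2, rfl⟩
  · rintro _ ⟨s, hs, rfl⟩
    rcases le_total s 0 with h' | h'
    · exact ⟨0, ⟨le_rfl, ht⟩, by simp [h.eq_zero_of_le s h', h.toFun_zero]⟩
    · exact ⟨s, ⟨h', hs⟩, rfl⟩

theorem dPlus_eq_rise (h : PathMap ℝ) : h.dPlus = rise LinearMap.id h := by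
  rw [dPlus, minOn_eq_future h h.len_nonneg]; rfl

theorem dMinus_eq_fall (h : PathMap ℝ) : h.dMinus = fall LinearMap.id h := by
  rw [dMinus, minOn_eq_future h h.len_nonneg, h.toFun_zero, zero_sub]; rfl

theorem rankOneF_eq_lowerOp {h : PathMap ℝ} (hb : HeightBdd LinearMap.id h) :
    rankOneF h = lowerOp LinearMap.id 2 h := by
  unfold rankOneF lowerOp
  rw [dPlus_eq_rise]
  split_ifs
  · congr 1
    ext t
    · rfl
    · rw [← toFun_clamp (lower LinearMap.id 2 1 h)]
      have := clamp_mem h t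
      simp only [ofFun, len_lower, lower_toFun, gain_eq hb zero_le_one,
        minOn_eq_future h this.2, minOn_eq_future h h.len_nonneg, smul_eq_mul]
      rw [mul_comm]
      rfl
  · rfl

theorem rankOneE_eq_raiseOp {h : PathMap ℝ} (hb : HeightBdd LinearMap.id h) :
    rankOneE h = raiseOp LinearMap.id 2 h := by
  by_cases hd : 1 ≤ h.dMinus
  · have hf : 1 ≤ fall LinearMap.id h := by rwa [← dMinus_eq_fall]
    rw [(raiseOp_eq_some hb).2 ⟨hf, rfl⟩, rankOneE, dif_pos hd]
    congr 1
    ext t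
    · rfl
    · rw [← toFun_clamp (raise LinearMap.id 2 1 h), raise_toFun hb zero_le_one hf]
      have := clamp_mem h t
      simp only [ofFun, minOn_eq_past h this.1, minOn_eq_future h h.len_nonneg, smul_eq_mul]
      rw [mul_comm]
      rfl
  · rw [rankOneE, dif_neg hd, eq_comm, raiseOp_eq_none hb, ← dMinus_eq_fall]
    exact not_le.1 hd

/-- Operators that agree only on `B` have equal powers there because `B` is stable under one of
them. -/
theorem power_congr {X : Type*} {B : Set X} {g g' : X → Option X} (h : ∀ x ∈ B, g x = g' x)
    (hB : ∀ x ∈ B, ∀ y, g' x = some y → y ∈ B) {x : X} (hx : x ∈ B) (n : ℕ) :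
    power g n x = power g' n x ∧ ∀ y, power g' n x = some y → y ∈ B := by
  induction n with
  | zero => exact ⟨rfl, fun y hy => Option.some_injective _ hy ▸ hx⟩
  | succ n ih =>
    rw [power, power, ih.1]
    cases hy : power g' n x with
    | none => exact ⟨rfl, fun y hy => by simp at hy⟩
    | some z => exact ⟨h z (ih.2 z hy), hB z (ih.2 z hy)⟩

theorem HasClosedGraph.congr {V : Type*} [AddCommGroup V] [Module ℝ V] {B : Set (PathMap V)}
    {g g' : PathMap V → Option (PathMap V)} (hg : HasClosedGraph B g') (h : ∀ x ∈ B, g x = g' x) :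
    HasClosedGraph B g := by
  intro p x p₀ x₀ hp hx hp₀ hx₀ hgx
  rw [h _ hp₀]
  exact hg p x p₀ x₀ hp hx hp₀ hx₀ fun n => by rw [← h _ (hp n)]; exact hgx n

/-- The reflection `x ↦ -x` of the real line. -/
def rankOneDatum : ReflectionDatum ℝ where
  φ := LinearMap.id
  α := 2
  Λ := {1, -1, 0}
  apply_root := rfl
  neg_mem μ hμ := by
    rcases hμ with rfl | rfl | rfl <;> simp
  reflect_mem μ hμ := by
    rcases hμ with rfl | rfl | rfl <;> norm_num

end RankOne

end PathMap

/-! ### The pairing procedure on words. -/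

namespace SignWord

open PathMap

theorem toPath_mem (w : List SignType) : toPath w ∈ rankOneDatum.paths := by
  induction w with
  | nil =>
    change trivial ℝ ∈ _
    rw [← stretch_zero (line 1)]
    exact ReflectionDatum.stretch_mem (ReflectionDatum.line_mem (by simp [rankOneDatum])) 0
  | cons x w ih =>
    refine ReflectionDatum.concat_mem (ReflectionDatum.line_mem ?_) ih
    cases x <;> simp [rankOneDatum]

theorem rise_line_one (x : ℝ) : rise LinearMap.id (line x) = max 0 x := by
  have := rise_stretch_line (φ := LinearMap.id) 1 x
  simpa using this

theorem fall_line_one (x : ℝ) : fall LinearMap.id (line x) = max 0 (-x) := by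
  have := fall_stretch_line (φ := LinearMap.id) 1 x
  simpa using this

theorem lowerOp_line_one (x : ℝ) (hx : x = 1) :
    lowerOp LinearMap.id 2 (line x) = some (line (-x)) := by
  subst hx
  have := lower_stretch_line (φ := LinearMap.id) (α := 2) (r := 1) (μ := (1 : ℝ)) (a := 1)
    (by simp) (by simp)
  rw [stretch_one, stretch_one] at this
  rw [lowerOp_of_le (by rw [rise_line_one]; simp), this]
  norm_num

theorem raiseOp_line_neg_one : raiseOp LinearMap.id 2 (line (-1 : ℝ)) = some (line 1) := by
  rw [raiseOp, reverse_line, neg_neg, lowerOp_line_one 1 rfl, Option.map_some, reverse_line, neg_neg]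

theorem natCast_sub_notMem_Ioo (a c : ℕ) : (a : ℝ) - c ∉ Set.Ioo (0 : ℝ) 1 := by
  rintro ⟨h1, h2⟩
  have h3 : c < a := by exact_mod_cast sub_pos.1 h1
  have h4 : (c : ℝ) + 1 ≤ a := by exact_mod_cast h3
  linarith

/-- Adding a letter in front is a concatenation with integral rise and fall, so the tensor rule
always applies, and its cases match the recursive clauses for words. -/
theorem pairing (w : List SignType) :
    rise LinearMap.id (toPath w) = unpairedPos w ∧
    fall LinearMap.id (toPath w) = unpairedNeg w ∧
    lowerOp LinearMap.id 2 (toPath w) = (opF w).map toPath ∧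
    raiseOp LinearMap.id 2 (toPath w) = (opE w).map toPath := by
  induction w with
  | nil =>
    have h1 : rise LinearMap.id (toPath []) = 0 := by
      change rise LinearMap.id (trivial ℝ) = 0
      rw [← stretch_zero (line 1), rise_stretch_line]; simp
    have h2 : fall LinearMap.id (toPath []) = 0 := by
      change fall LinearMap.id (trivial ℝ) = 0
      rw [← stretch_zero (line 1), fall_stretch_line]; simp
    have hb := ReflectionDatum.bdd (toPath_mem [])
    refine ⟨by simpa [unpairedPos] using h1, by simpa [unpairedNeg] using h2, ?_, ?_⟩
    · exact lowerOp_eq_none.2 (by rw [h1]; exact zero_lt_one)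
    · exact (raiseOp_eq_none hb).2 (h2.trans_lt zero_lt_one)
  | cons x w ih =>
    obtain ⟨h1, h2, h3, h4⟩ := ih
    have hw : HeightBdd LinearMap.id (toPath w) := ReflectionDatum.bdd (toPath_mem w)
    have hx : HeightBdd LinearMap.id (line (x : ℝ)) := by
      simpa using (isTame_stretch_line (φ := LinearMap.id) 1 (x : ℝ)).heightBdd
    have hr := rise_concat hx hw
    have hf := fall_concat hx hw
    have hlow := lowerOp_concat (α := 2) hx hw
    have hraise := raiseOp_concat (α := 2) hx hw
    rw [rise_line_one, h1, h2] at hr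
    rw [rise_line_one, fall_line_one, h2] at hf
    rw [rise_line_one, h2] at hlow hraise
    have hn : (0 : ℝ) ≤ unpairedNeg w := Nat.cast_nonneg _
    have hraise0 : unpairedNeg w = 0 → opE w = none := by
      intro h0
      rw [(raiseOp_eq_none hw).2 (by rw [h2, h0]; simp)] at h4
      simpa using h4.symm
    have hE0 : fall LinearMap.id (line (x : ℝ)) < 1 →
        raiseOp LinearMap.id 2 (line (x : ℝ)) = none := (raiseOp_eq_none hx).2
    rw [fall_line_one] at hE0
    cases x with
    | zero =>
      have hc : ((SignType.zero : SignType) : ℝ) = 0 := rfl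
      have hm := natCast_sub_notMem_Ioo 0 (unpairedNeg w)
      have hm' := natCast_sub_notMem_Ioo (unpairedNeg w) 0
      simp only [hc, neg_zero, max_self, zero_sub, sub_zero, Nat.cast_zero] at *
      refine ⟨?_, ?_, ?_, ?_⟩
      · exact hr.trans (by rw [max_eq_left (by linarith), add_zero]; rfl)
      · exact hf.trans (by rw [max_eq_right hn, zero_add]; rfl)
      · refine ((hlow hm).2 hn).trans ?_
        rw [h3, opF, Option.map_map, Option.map_map]; rfl
      · rcases Nat.eq_zero_or_pos (unpairedNeg w) with h0 | h0
        · refine ((hraise hm').1 (by rw [h0, Nat.cast_zero])).trans ?_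
          rw [hE0 zero_lt_one, opE, hraise0 h0]; rfl
        · refine ((hraise hm').2 (Nat.cast_pos.2 h0)).trans ?_
          rw [h4, opE, Option.map_map, Option.map_map]; rfl
    | neg =>
      have hc : ((SignType.neg : SignType) : ℝ) = -1 := rfl
      have hm := natCast_sub_notMem_Ioo 0 (unpairedNeg w)
      have hm' := natCast_sub_notMem_Ioo (unpairedNeg w) 0
      have h01 : max (0 : ℝ) (-1) = 0 := by norm_num
      have h02 : max (0 : ℝ) 1 = 1 := by norm_num
      simp only [hc, neg_neg, h01, h02, zero_sub, sub_zero, Nat.cast_zero] at *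
      refine ⟨?_, ?_, ?_, ?_⟩
      · exact hr.trans (by rw [max_eq_left (by linarith), add_zero]; rfl)
      · exact hf.trans (by rw [max_eq_right hn, unpairedNeg]; push_cast; ring)
      · refine ((hlow hm).2 hn).trans ?_
        rw [h3, opF, Option.map_map, Option.map_map]; rfl
      · rcases Nat.eq_zero_or_pos (unpairedNeg w) with h0 | h0
        · refine ((hraise hm').1 (by rw [h0, Nat.cast_zero])).trans ?_
          rw [raiseOp_line_neg_one, opE, if_pos h0]; rfl
        · refine ((hraise hm').2 (Nat.cast_pos.2 h0)).trans ?_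
          rw [h4, opE, if_neg h0.ne', Option.map_map, Option.map_map]; rfl
    | pos =>
      have hc : ((SignType.pos : SignType) : ℝ) = 1 := rfl
      have hm := natCast_sub_notMem_Ioo 1 (unpairedNeg w)
      have hm' := natCast_sub_notMem_Ioo (unpairedNeg w) 1
      have h01 : max (0 : ℝ) (-1) = 0 := by norm_num
      have h02 : max (0 : ℝ) 1 = 1 := by norm_num
      simp only [hc, h01, h02, Nat.cast_one, zero_add] at *
      rw [unpairedPos, unpairedNeg, opF, opE]
      rcases Nat.eq_zero_or_pos (unpairedNeg w) with h0 | h0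
      · rw [if_pos h0, if_pos h0, if_pos (by omega)]
        simp only [h0, Nat.cast_zero, sub_zero, zero_sub] at *
        refine ⟨?_, ?_, ?_, ?_⟩
        · exact hr.trans (by rw [max_eq_right zero_le_one]; push_cast; ring)
        · exact hf.trans (by rw [max_eq_left (by norm_num)]; simp)
        · refine ((hlow hm).1 zero_lt_one).trans ?_
          rw [lowerOp_line_one 1 rfl]; rfl
        · refine ((hraise hm').1 zero_le_one).trans ?_
          rw [hE0 zero_lt_one]; rfl
      · have h1' : (1 : ℝ) ≤ unpairedNeg w := Nat.one_le_cast.2 h0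
        rw [if_neg h0.ne', if_neg h0.ne']
        refine ⟨?_, ?_, ?_, ?_⟩
        · exact hr.trans (by rw [max_eq_left (by linarith), add_zero])
        · exact hf.trans (by rw [max_eq_right (by linarith), Nat.cast_sub h0, Nat.cast_one])
        · refine ((hlow hm).2 h1').trans ?_
          rw [h3, Option.map_map, Option.map_map]; rfl
        · rcases (Nat.succ_le_of_lt h0).eq_or_lt with h | h
          · rw [if_pos (by omega)]
            refine ((hraise hm').1 (by rw [← h]; simp)).trans ?_
            rw [hE0 zero_lt_one]; rfl
          · rw [if_neg (by omega)]
            refine ((hraise hm').2 (by exact_mod_cast h)).trans ?_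
            rw [h4, Option.map_map, Option.map_map]; rfl

theorem extendPairing : ExtendPairing dPlus dMinus rankOneE rankOneF := by
  have hF : ∀ h ∈ rankOnePaths, rankOneF h = rankOneDatum.f h := fun h hh =>
    rankOneF_eq_lowerOp (ReflectionDatum.bdd (T := rankOneDatum) hh)
  have hE : ∀ h ∈ rankOnePaths, rankOneE h = rankOneDatum.e h := fun h hh =>
    rankOneE_eq_raiseOp (ReflectionDatum.bdd (T := rankOneDatum) hh)
  have hFm : ∀ h ∈ rankOnePaths, ∀ y, rankOneDatum.f h = some y → y ∈ rankOnePaths :=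
    fun h hh y => ReflectionDatum.f_mem hh
  have hEm : ∀ h ∈ rankOnePaths, ∀ y, rankOneDatum.e h = some y → y ∈ rankOnePaths :=
    fun h hh y => ReflectionDatum.e_mem hh
  refine ⟨fun w => ?_, fun h hh r hr => ⟨?_, ?_⟩, ?_, ?_⟩
  · rw [dPlus_eq_rise, dMinus_eq_fall, hF _ (toPath_mem w), hE _ (toPath_mem w)]
    exact pairing w
  · rw [hF h hh, (power_congr hF hFm (ReflectionDatum.stretch_mem (T := rankOneDatum) hh _) r).1]
    exact ReflectionDatum.power_f_stretch hh r (.inl hr)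
  · rw [hE h hh, (power_congr hE hEm (ReflectionDatum.stretch_mem (T := rankOneDatum) hh _) r).1]
    exact ReflectionDatum.power_e_stretch hh r (.inl hr)
  · exact (ReflectionDatum.hasClosedGraph_e rankOneDatum).congr hE
  · exact (ReflectionDatum.hasClosedGraph_f rankOneDatum).congr hF

end SignWord

/-! ### The root operators as operators of a reflection datum. -/

namespace RootPaths

open PathMap

variable {ι V N : Type*} [AddCommGroup V] [Module ℝ V] [AddCommGroup N] [Module ℝ N]
  (R : RootPairing ι ℝ V N)

/-- The simple reflection acting on the weight lattice. -/
def datum [R.IsCrystallographic] (i : ι) : ReflectionDatum V where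
  φ := R.toLinearMap.flip (R.coroot i)
  α := R.root i
  Λ := weightLattice R
  apply_root := R.root_coroot_two i
  neg_mem μ hμ j := by
    obtain ⟨n, hn⟩ := hμ j
    exact ⟨-n, by simp [hn]⟩
  reflect_mem μ hμ j := by
    obtain ⟨n, hn⟩ := hμ j
    obtain ⟨m, hm⟩ := hμ i
    obtain ⟨k, hk⟩ := R.exists_value (S := ℤ) i j
    refine ⟨n - m * k, ?_⟩
    have : R.toLinearMap (R.root i) (R.coroot j) = k := by
      rw [← RootPairing.pairing, ← hk]; rfl
    simp [hn, hm, this]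

variable {R}

theorem proj_toFun (i : ι) (p : PathMap V) (t : ℝ) :
    (proj R i p).toFun t = R.toLinearMap (p.toFun t) (R.coroot i) := by
  unfold proj
  change R.toLinearMap (p.toFun (max 0 (min t p.len))) (R.coroot i) = _
  rw [toFun_clamp]

variable [R.IsCrystallographic] {i : ι} {p : PathMap V}

theorem dP_eq_rise : dP R i p = rise (datum R i).φ p := by
  rw [dP, dPlus_eq_rise]
  simp [rise, base, future, wt, proj_toFun, datum]
  rfl

theorem dM_eq_fall : dM R i p = fall (datum R i).φ p := by
  rw [dM, dMinus_eq_fall]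
  simp [fall, base, future, proj_toFun, datum]

theorem heightBdd_proj (hp : HeightBdd (datum R i).φ p) :
    HeightBdd LinearMap.id (proj R i p) := by
  obtain ⟨B, hB⟩ := hp
  exact ⟨B, fun t => by rw [proj_toFun]; exact hB t⟩

theorem future_proj (t : ℝ) :
    future LinearMap.id (proj R i p) t = future (datum R i).φ p t := by
  simp [future, proj_toFun, datum]

theorem past_proj (t : ℝ) : past LinearMap.id (proj R i p) t = past (datum R i).φ p t := by
  simp [past, proj_toFun, datum]

/-- Projection to the coroot preserves heights, hence futures. The rank one operator moves the
projection by twice the gain, and the factor ½ leaves the gain as the coefficient of the root. -/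
theorem rootF_eq (hp : p ∈ BUniv R) : rootF R i p = (datum R i).f p := by
  have hb : HeightBdd (datum R i).φ p := ReflectionDatum.bdd (T := datum R i) hp
  rw [rootF, rankOneF_eq_lowerOp (heightBdd_proj hb)]
  have hr : rise LinearMap.id (proj R i p) = rise (datum R i).φ p := by
    rw [← dP_eq_rise, dP, dPlus_eq_rise]
  unfold ReflectionDatum.f lowerOp
  rw [hr]
  split_ifs
  · rw [Option.map_some]
    congr 1
    ext t
    · rfl
    · rw [← toFun_clamp (lower (datum R i).φ (datum R i).α 1 p)]
      simp only [ofFun, len_lower, lower_toFun, gain, future_proj, base]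
      rw [smul_eq_mul]
      congr 2
      ring
  · rfl

theorem rootE_eq (hp : p ∈ BUniv R) : rootE R i p = (datum R i).e p := by
  have hb : HeightBdd (datum R i).φ p := ReflectionDatum.bdd (T := datum R i) hp
  have hb' := heightBdd_proj hb
  rw [rootE, rankOneE_eq_raiseOp hb']
  have hf : fall LinearMap.id (proj R i p) = fall (datum R i).φ p := by
    rw [← dM_eq_fall, dM, dMinus_eq_fall]
  unfold ReflectionDatum.e
  rcases le_or_gt 1 (fall (datum R i).φ p) with h | h
  · rw [(raiseOp_eq_some hb).2 ⟨h, rfl⟩, (raiseOp_eq_some hb').2 ⟨hf ▸ h, rfl⟩, Option.map_some]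
    congr 1
    ext t
    · rfl
    · rw [← toFun_clamp (raise (datum R i).φ (datum R i).α 1 p),
        raise_toFun hb zero_le_one h]
      simp only [ofFun, len_raise, raise_toFun hb' zero_le_one (hf ▸ h), past_proj, base, future_proj]
      rw [smul_eq_mul]
      congr 2
      ring
  · rw [(raiseOp_eq_none hb).2 h, (raiseOp_eq_none hb').2 (hf ▸ h), Option.map_none]

theorem tensorRule (i : ι) : TensorRule R i (rootE R i) (rootF R i) := by
  intro p hp q hq
  have hpq : p.concat q ∈ BUniv R := ReflectionDatum.concat_mem (T := datum R i) hp hq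
  have hbp : HeightBdd (datum R i).φ p := ReflectionDatum.bdd (T := datum R i) hp
  have hbq : HeightBdd (datum R i).φ q := ReflectionDatum.bdd (T := datum R i) hq
  rw [rootF_eq hp, rootF_eq hq, rootF_eq hpq, rootE_eq hp, rootE_eq hq, rootE_eq hpq,
    dP_eq_rise, dM_eq_fall]
  refine ⟨fun h => ?_, fun h => ?_⟩
  · have := lowerOp_concat (α := (datum R i).α) hbp hbq h
    split_ifs with hlt
    · exact this.1 hlt
    · exact this.2 (not_lt.1 hlt)
  · have := raiseOp_concat (α := (datum R i).α) hbp hbq h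
    split_ifs with hle
    · exact this.1 hle
    · exact this.2 (not_le.1 hle)

theorem reflection_eq (μ : V) :
    R.reflection i μ = μ - (datum R i).φ μ • (datum R i).α := R.reflection_apply i μ

theorem isRootOperatorPair (i : ι) : IsRootOperatorPair R i (rootE R i) (rootF R i) := by
  have hF : ∀ p ∈ BUniv R, rootF R i p = (datum R i).f p := fun p hp => rootF_eq hp
  have hE : ∀ p ∈ BUniv R, rootE R i p = (datum R i).e p := fun p hp => rootE_eq hp
  have hFm : ∀ p ∈ BUniv R, ∀ q, (datum R i).f p = some q → q ∈ BUniv R :=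
    fun p hp q => ReflectionDatum.f_mem hp
  have hEm : ∀ p ∈ BUniv R, ∀ q, (datum R i).e p = some q → q ∈ BUniv R :=
    fun p hp q => ReflectionDatum.e_mem hp
  have hst : ∀ p ∈ BUniv R, ∀ r : ℝ≥0, p.stretch r ∈ BUniv R :=
    fun p hp r => ReflectionDatum.stretch_mem (T := datum R i) hp r
  have hrev : ∀ p ∈ BUniv R, p.reverse ∈ BUniv R :=
    fun p hp => ReflectionDatum.reverse_mem (T := datum R i) hp
  constructor
  · intro p hp q h
    exact hFm p hp q (hF p hp ▸ h)
  · intro p hp q h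
    exact hEm p hp q (hE p hp ▸ h)
  · intro p hp q h
    rw [hF p hp] at h
    rw [hE q (hFm p hp q h)]
    exact ReflectionDatum.e_f hp h
  · intro p hp q h
    rw [hE p hp] at h
    rw [hF q (hEm p hp q h)]
    exact ReflectionDatum.f_e hp h
  · intro μ hμ n _ h
    rw [(power_congr hF hFm (ReflectionDatum.line_mem (T := datum R i) hμ) n).1, reflection_eq]
    exact ReflectionDatum.power_f_line hμ h
  · intro p hp q hq a c ha hc
    have h := tensorRule i p hp q hq
    rw [ha, hc] at h
    have h1 := h.1 (SignWord.natCast_sub_notMem_Ioo a c)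
    have h2 := h.2 (SignWord.natCast_sub_notMem_Ioo c a)
    simp only [gt_iff_lt, ge_iff_le, Nat.cast_lt, Nat.cast_le] at h1 h2 ⊢
    exact ⟨by convert h1, by convert h2⟩
  · intro p hp r hr
    rw [hF p hp] at hr ⊢
    rw [(power_congr hF hFm (hst p hp r) r).1]
    exact ReflectionDatum.power_f_stretch hp r hr
  · intro p hp r hr
    rw [hE p hp] at hr ⊢
    rw [(power_congr hE hEm (hst p hp r) r).1]
    exact ReflectionDatum.power_e_stretch hp r hr
  · intro p hp
    rw [hF _ (hrev p hp), hE p hp]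
    exact lowerOp_reverse p
  · intro p hp
    rw [hE _ (hrev p hp), hF p hp]
    exact raiseOp_reverse p
  · intro p hp q h
    exact ReflectionDatum.wt_f (T := datum R i) hp (hF p hp ▸ h)
  · intro p hp q h
    exact ReflectionDatum.wt_e (T := datum R i) hp (hE p hp ▸ h)

end RootPaths

end

noncomputable section

open Filter Topology

/-! ### Uniqueness: consequences of the axioms. -/

namespace RootPaths

open PathMap

variable {ι V N : Type*} [AddCommGroup V] [Module ℝ V] [AddCommGroup N] [Module ℝ N]
  {R : RootPairing ι ℝ V N} {i : ι} {e f : PathMap V → Option (PathMap V)} {p q : PathMap V}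

theorem reverse_mem (hp : p ∈ BUniv R) : p.reverse ∈ BUniv R := Generated.reverse p hp

theorem concat_mem (hp : p ∈ BUniv R) (hq : q ∈ BUniv R) : p.concat q ∈ BUniv R :=
  Generated.concat p q hp hq

theorem stretch_mem (hp : p ∈ BUniv R) (r : ℝ≥0) : p.stretch r ∈ BUniv R :=
  Generated.stretch r (Set.mem_univ _) p hp

theorem line_mem {μ : V} (hμ : μ ∈ weightLattice R) : line μ ∈ BUniv R := Generated.line μ hμ

theorem bRat_subset : BRat R ⊆ BUniv R := by
  intro p hp
  change Generated _ _ p at hp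
  induction hp with
  | line μ hμ => exact line_mem hμ
  | concat p q _ _ hp hq => exact concat_mem hp hq
  | reverse p _ hp => exact reverse_mem hp
  | stretch r _ p _ hp => exact stretch_mem hp r

/-- The reversal axiom expresses `e` through `f`, so agreement of the lowering operators on a
reversal-stable set suffices. -/
theorem eq_of_f_eq {B : Set (PathMap V)} {e' f' : PathMap V → Option (PathMap V)}
    (hB : B ⊆ BUniv R) (hBr : ∀ p ∈ B, p.reverse ∈ B) (h : IsRootOperatorPair R i e f)
    (h' : IsRootOperatorPair R i e' f') (hf : ∀ p ∈ B, f p = f' p) :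
    ∀ p ∈ B, e p = e' p ∧ f p = f' p := by
  intro p hp
  refine ⟨?_, hf p hp⟩
  rw [← reverse_reverse p, h.reverse_e _ (hB (hBr p hp)), h'.reverse_e _ (hB (hBr p hp)),
    hf _ (hBr p hp)]

variable [R.IsCrystallographic]

theorem bdd (i : ι) (hp : p ∈ BUniv R) : HeightBdd (datum R i).φ p :=
  ReflectionDatum.bdd (T := datum R i) hp

theorem root_mem_weightLattice (i : ι) : R.root i ∈ weightLattice R := by
  intro j
  obtain ⟨k, hk⟩ := R.exists_value (S := ℤ) i j
  exact ⟨k, by rw [R.root_coroot_eq_pairing, ← hk]; rfl⟩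

/-- Stretching the short segment by `n` gives the full line, on which the `n`-th power of `f` is
prescribed; injectivity of stretching brings the value back. -/
theorem f_stretch_inv_line (h : IsRootOperatorPair R i e f) {μ : V} (hμ : μ ∈ weightLattice R)
    {n : ℕ} (hn : 0 < n) (hφ : (datum R i).φ μ = n) :
    f ((line μ).stretch (n : ℝ≥0)⁻¹)
      = some ((line (μ - (n : ℝ) • R.root i)).stretch (n : ℝ≥0)⁻¹) := by
  have hn' : (n : ℝ≥0) ≠ 0 := Nat.cast_ne_zero.2 hn.ne'
  have h1 := h.stretch_f _ (stretch_mem (line_mem hμ) (n : ℝ≥0)⁻¹) n (.inl hn)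
  have hs : ∀ ν : V, ((line ν).stretch (n : ℝ≥0)⁻¹).stretch n = line ν := fun ν => by
    rw [stretch_stretch, mul_inv_cancel₀ hn', stretch_one]
  rw [hs, h.line μ hμ n hn hφ] at h1
  obtain ⟨x, hx, hx'⟩ := Option.map_eq_some_iff.1 h1.symm
  rw [hx]
  congr 1
  apply stretch_injective hn'
  rw [hx', hs, reflection_eq, hφ]
  rfl

/-- If `f p = y`, the tensor rule and the weights give `y` rise 0 and fall `c + 2`. A test path `q`
of fall `c + 1` lies strictly between the rises `c` of `p*` and `c + 2` of `y*`. Thus `f` acts on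
`y* ⊗ q` through the left factor, while its inverse `e` acts on `p* ⊗ q` through the right one,
which is inconsistent. -/
theorem f_eq_none (h : IsRootOperatorPair R i e f) (hp : p ∈ BUniv R)
    (hr : rise (datum R i).φ p = 0) {c : ℕ} (hc : fall (datum R i).φ p = c) : f p = none := by
  by_contra hne
  obtain ⟨y, hy⟩ := Option.ne_none_iff_exists'.1 hne
  have hym := h.mem_f p hp y hy
  have hey := h.e_f p hp y hy
  have hα : (datum R i).φ (R.root i) = 2 := (datum R i).apply_root
  -- Cut `y` at its minimum. Since the adjoining rise and fall are both 0, `e` acts on the first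
  -- piece, so the second piece survives as the end of `p` and must have rise 0.
  have hry : rise (datum R i).φ y = 0 := by
    obtain ⟨y₁, hy₁, y₂, hy₂, rfl, h1, h2⟩ :=
      ReflectionDatum.exists_split (T := datum R i) (p := y) hym
    have h3 := (h.concat y₁ hy₁ y₂ hy₂ 0 0 (by simp [dP_eq_rise, h1])
      (by simp [dM_eq_fall, h2])).2
    rw [if_pos le_rfl, hey] at h3
    obtain ⟨z, hz, rfl⟩ := Option.map_eq_some_iff.1 h3.symm
    have hzm := h.mem_e y₁ hy₁ z hz
    rw [rise_concat (bdd i hzm) (bdd i hy₂)] at hr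
    have h4 := rise_nonneg (bdd i hy₂)
    have h5 := le_max_left 0 (rise (datum R i).φ z - fall (datum R i).φ y₂)
    rw [rise_concat (bdd i hy₁) (bdd i hy₂), h1, h2, sub_self, max_self]
    linarith
  have hfy : fall (datum R i).φ y = (c + 2 : ℕ) := by
    have h1 := rise_sub_fall (φ := (datum R i).φ) y
    have h2 := rise_sub_fall (φ := (datum R i).φ) p
    rw [h.wt_f p hp y hy, map_sub, hα, ← h2, hry, hr, hc] at h1
    push_cast
    linarith
  have hroot := root_mem_weightLattice (R := R) i
  have hnroot : -R.root i ∈ weightLattice R := (datum R i).neg_mem _ hroot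
  -- Half of the root line has height 1; `f` takes it to `v`, so `e v = u` is known from the axioms.
  set u := (line (R.root i)).stretch ((2 : ℕ) : ℝ≥0)⁻¹ with hu
  set v := (line (-R.root i)).stretch ((2 : ℕ) : ℝ≥0)⁻¹ with hv
  have hum : u ∈ BUniv R := stretch_mem (line_mem hroot) _
  have hvm : v ∈ BUniv R := stretch_mem (line_mem hnroot) _
  have hev : e v = some u := by
    apply h.e_f u hum
    rw [hu, f_stretch_inv_line h hroot two_pos (by rw [hα]; rfl)]
    congr 3
    rw [Nat.cast_ofNat]
    module
  have hrv : rise (datum R i).φ v = 0 := by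
    rw [hv, rise_stretch_line, map_neg, hα]; simp
  have hfv : fall (datum R i).φ v = 1 := by
    rw [hv, fall_stretch_line, map_neg, hα]; simp
  set w := v.stretch c with hw
  have hwm : w ∈ BUniv R := stretch_mem hvm _
  have hrw : rise (datum R i).φ w = 0 := by
    rw [hw, rise_stretch (bdd i hvm), hrv, mul_zero]
  have hfw : fall (datum R i).φ w = c := by
    rw [hw, fall_stretch (bdd i hvm), hfv, mul_one]; rfl
  have hfq : fall (datum R i).φ (w.concat v) = (c + 1 : ℕ) := by
    rw [fall_concat (bdd i hwm) (bdd i hvm), hfw, hfv, hrw]; simp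
  have hqm := concat_mem hwm hvm
  -- Here `f` acts on the left: `f (y* ⊗ q) = p* ⊗ q`, where `q = w ⊗ v`.
  have h1 := (h.concat _ (reverse_mem hym) _ hqm (c + 2) (c + 1)
    (by rw [dP_eq_rise, rise_reverse (bdd i hym), hfy]) (by rw [dM_eq_fall, hfq])).1
  rw [if_pos (by omega), h.reverse_f y hym, hey, Option.map_some, Option.map_some] at h1
  have h2 := h.e_f _ (concat_mem (reverse_mem hym) hqm) _ h1
  -- Here `e` acts on the right, and within `q` on `v`, so `y* ⊗ w ⊗ v = p* ⊗ w ⊗ u`.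
  have h3 := (h.concat _ (reverse_mem hp) _ hqm c (c + 1)
    (by rw [dP_eq_rise, rise_reverse (bdd i hp), hc]) (by rw [dM_eq_fall, hfq])).2
  have h4 := (h.concat _ hwm _ hvm 0 1
    (by rw [dP_eq_rise, hrw]; simp) (by rw [dM_eq_fall, hfv]; simp)).2
  rw [if_neg (by omega), hev, Option.map_some] at h4
  rw [if_neg (by omega), h4, h2, Option.map_some, Option.some_inj] at h3
  have hlen := congrArg PathMap.len h3
  simp only [len_concat, len_reverse, hu, hv, len_stretch, len_line] at hlen
  have hlen' : y.len = p.len := by linarith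
  -- Equal lengths put the first joint of both sides at time `p.len`; comparing values there gives
  -- equal weights for `y` and `p`, hence a vanishing root.
  have hval := congrArg (fun x => PathMap.toFun x p.len) h3
  simp only [concat_toFun, len_reverse, hlen', sub_self, toFun_zero, zero_sub] at hval
  rw [u.eq_zero_of_le _ (by linarith [w.len_nonneg]),
    v.eq_zero_of_le _ (by linarith [w.len_nonneg])] at hval
  rw [zero_add, add_zero, add_zero] at hval
  have hwt : y.reverse.wt = p.reverse.wt := by
    change y.reverse.toFun y.len = p.reverse.toFun p.len
    rw [hlen']; exact hval
  rw [wt_reverse, wt_reverse, neg_inj, h.wt_f p hp y hy, sub_eq_self] at hwt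
  rw [hwt, map_zero] at hα
  exact two_ne_zero hα.symm

/-- Concatenations of segments whose height changes by `1`, `-1` or `0`. -/
inductive UnitSteps (R : RootPairing ι ℝ V N) [R.IsCrystallographic] (i : ι) : PathMap V → Prop
  | pos (μ : V) (hμ : μ ∈ weightLattice R) (n : ℕ) (hn : 0 < n) (h : (datum R i).φ μ = n) :
      UnitSteps R i ((line μ).stretch (n : ℝ≥0)⁻¹)
  | neg (μ : V) (hμ : μ ∈ weightLattice R) (n : ℕ) (hn : 0 < n) (h : (datum R i).φ μ = -n) :
      UnitSteps R i ((line μ).stretch (n : ℝ≥0)⁻¹)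
  | zero (μ : V) (hμ : μ ∈ weightLattice R) (r : ℝ≥0) (h : (datum R i).φ μ = 0) :
      UnitSteps R i ((line μ).stretch r)
  | concat (p q : PathMap V) : UnitSteps R i p → UnitSteps R i q → UnitSteps R i (p.concat q)

/-! ### Uniqueness on rational paths. -/

namespace UnitSteps

theorem mem (hp : UnitSteps R i p) : p ∈ BUniv R := by
  induction hp with
  | pos μ hμ n hn h => exact stretch_mem (line_mem hμ) _
  | neg μ hμ n hn h => exact stretch_mem (line_mem hμ) _
  | zero μ hμ r h => exact stretch_mem (line_mem hμ) _
  | concat p q _ _ hp hq => exact concat_mem hp hq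

theorem rise_fall_neg {μ : V} {n : ℕ} (hn : 0 < n) (h : (datum R i).φ μ = -n) :
    rise (datum R i).φ ((line μ).stretch (n : ℝ≥0)⁻¹) = 0 ∧
    fall (datum R i).φ ((line μ).stretch (n : ℝ≥0)⁻¹) = (1 : ℕ) := by
  have hn' : (n : ℝ) ≠ 0 := Nat.cast_ne_zero.2 hn.ne'
  rw [rise_stretch_line, fall_stretch_line, h]
  simp [hn']

theorem rise_fall_pos {μ : V} {n : ℕ} (hn : 0 < n) (h : (datum R i).φ μ = n) :
    rise (datum R i).φ ((line μ).stretch (n : ℝ≥0)⁻¹) = (1 : ℕ) ∧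
    fall (datum R i).φ ((line μ).stretch (n : ℝ≥0)⁻¹) = (0 : ℕ) := by
  have hn' : (n : ℝ) ≠ 0 := Nat.cast_ne_zero.2 hn.ne'
  rw [rise_stretch_line, fall_stretch_line, h]
  simp [hn']

theorem rise_fall_zero {μ : V} {r : ℝ≥0} (h : (datum R i).φ μ = 0) :
    rise (datum R i).φ ((line μ).stretch r) = 0 ∧
    fall (datum R i).φ ((line μ).stretch r) = (0 : ℕ) := by
  rw [rise_stretch_line, fall_stretch_line, h]
  simp

/-- Integrality is what makes the tensor axiom applicable at every joint. -/
theorem exists_rise_fall (hp : UnitSteps R i p) :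
    ∃ a c : ℕ, rise (datum R i).φ p = a ∧ fall (datum R i).φ p = c := by
  induction hp with
  | pos μ hμ n hn h => exact ⟨1, 0, rise_fall_pos hn h⟩
  | neg μ hμ n hn h => exact ⟨0, 1, by simpa using rise_fall_neg hn h⟩
  | zero μ hμ r h => exact ⟨0, 0, by simpa using rise_fall_zero h⟩
  | concat p q hp hq ihp ihq =>
    obtain ⟨a, c, ha, hc⟩ := ihp
    obtain ⟨a', c', ha', hc'⟩ := ihq
    have hsub : ∀ x y : ℕ, max 0 ((x : ℝ) - y) = (x - y : ℕ) := by
      intro x y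
      rcases le_total y x with h | h
      · rw [Nat.cast_sub h, max_eq_right (sub_nonneg.2 (Nat.cast_le.2 h))]
      · rw [Nat.sub_eq_zero_of_le h, max_eq_left (sub_nonpos.2 (Nat.cast_le.2 h)), Nat.cast_zero]
    refine ⟨a' + (a - c'), c + (c' - a), ?_, ?_⟩
    · rw [rise_concat (bdd i hp.mem) (bdd i hq.mem), ha, ha', hc', hsub, Nat.cast_add]
    · rw [fall_concat (bdd i hp.mem) (bdd i hq.mem), hc, ha, hc', hsub, Nat.cast_add]

/-- Stability of the class is needed to compare powers of two operators, not just single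
applications. -/
theorem f_mem (h : IsRootOperatorPair R i e f) (hp : UnitSteps R i p) :
    ∀ q, f p = some q → UnitSteps R i q := by
  induction hp with
  | pos μ hμ n hn hφ =>
    intro q hq
    rw [f_stretch_inv_line h hμ hn hφ, Option.some_inj] at hq
    subst hq
    refine .neg _ ?_ n hn ?_
    · rw [← hφ]; exact (datum R i).reflect_mem μ hμ
    · rw [map_sub, map_smul, hφ, show R.root i = (datum R i).α from rfl,
        (datum R i).apply_root, smul_eq_mul]
      ring
  | neg μ hμ n hn hφ =>
    intro q hq
    obtain ⟨h1, h2⟩ := rise_fall_neg hn hφ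
    rw [f_eq_none h (mem (.neg μ hμ n hn hφ)) h1 h2] at hq
    simp at hq
  | zero μ hμ r hφ =>
    intro q hq
    obtain ⟨h1, h2⟩ := rise_fall_zero (r := r) hφ
    rw [f_eq_none h (mem (.zero μ hμ r hφ)) h1 h2] at hq
    simp at hq
  | concat p q hp hq ihp ihq =>
    intro x hx
    obtain ⟨a, -, ha, -⟩ := hp.exists_rise_fall
    obtain ⟨-, c, -, hc⟩ := hq.exists_rise_fall
    rw [(h.concat p hp.mem q hq.mem a c (dP_eq_rise.trans ha) (dM_eq_fall.trans hc)).1] at hx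
    split_ifs at hx
    · obtain ⟨y, hy, rfl⟩ := Option.map_eq_some_iff.1 hx
      exact .concat _ _ (ihp y hy) hq
    · obtain ⟨y, hy, rfl⟩ := Option.map_eq_some_iff.1 hx
      exact .concat _ _ hp (ihq y hy)

theorem f_eq {e' f' : PathMap V → Option (PathMap V)} (h : IsRootOperatorPair R i e f)
    (h' : IsRootOperatorPair R i e' f') (hp : UnitSteps R i p) : f p = f' p := by
  induction hp with
  | pos μ hμ n hn hφ =>
    rw [f_stretch_inv_line h hμ hn hφ, f_stretch_inv_line h' hμ hn hφ]
  | neg μ hμ n hn hφ =>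
    obtain ⟨h1, h2⟩ := rise_fall_neg hn hφ
    rw [f_eq_none h (mem (.neg μ hμ n hn hφ)) h1 h2, f_eq_none h' (mem (.neg μ hμ n hn hφ)) h1 h2]
  | zero μ hμ r hφ =>
    obtain ⟨h1, h2⟩ := rise_fall_zero (r := r) hφ
    rw [f_eq_none h (mem (.zero μ hμ r hφ)) h1 h2, f_eq_none h' (mem (.zero μ hμ r hφ)) h1 h2]
  | concat p q hp hq ihp ihq =>
    obtain ⟨a, -, ha, -⟩ := hp.exists_rise_fall
    obtain ⟨-, c, -, hc⟩ := hq.exists_rise_fall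
    rw [(h.concat p hp.mem q hq.mem a c (dP_eq_rise.trans ha) (dM_eq_fall.trans hc)).1,
      (h'.concat p hp.mem q hq.mem a c (dP_eq_rise.trans ha) (dM_eq_fall.trans hc)).1, ihp, ihq]

theorem reverse (hp : UnitSteps R i p) : UnitSteps R i p.reverse := by
  induction hp with
  | pos μ hμ n hn h =>
    rw [reverse_stretch, reverse_line]
    exact .neg _ ((datum R i).neg_mem μ hμ) n hn (by rw [map_neg, h])
  | neg μ hμ n hn h =>
    rw [reverse_stretch, reverse_line]
    exact .pos _ ((datum R i).neg_mem μ hμ) n hn (by rw [map_neg, h, neg_neg])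
  | zero μ hμ r h =>
    rw [reverse_stretch, reverse_line]
    exact .zero _ ((datum R i).neg_mem μ hμ) r (by rw [map_neg, h, neg_zero])
  | concat p q _ _ hp hq => rw [reverse_concat]; exact .concat _ _ hq hp

theorem trivial_mem : UnitSteps R i (trivial V) := by
  rw [← stretch_zero (line 0)]
  exact .zero 0 (fun j => ⟨0, by simp⟩) 0 (map_zero _)

theorem nsmul_line {r : ℝ≥0} {μ : V} (h : UnitSteps R i ((line μ).stretch r)) (k : ℕ) :
    UnitSteps R i ((line μ).stretch (k * r)) := by
  induction k with
  | zero => rw [Nat.cast_zero, zero_mul, stretch_zero]; exact trivial_mem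
  | succ k ih =>
    rw [Nat.cast_succ, add_mul, one_mul, stretch_add_line]
    exact .concat _ _ ih h

theorem stretch (hp : UnitSteps R i p) (k : ℕ) : UnitSteps R i (p.stretch k) := by
  induction hp with
  | pos μ hμ n hn h => rw [stretch_stretch]; exact nsmul_line (.pos μ hμ n hn h) k
  | neg μ hμ n hn h => rw [stretch_stretch]; exact nsmul_line (.neg μ hμ n hn h) k
  | zero μ hμ r h => rw [stretch_stretch]; exact .zero μ hμ _ h
  | concat p q _ _ hp hq => rw [stretch_concat]; exact .concat _ _ hp hq

/-- A line of nonzero integral height ±k is the concatenation of `k` copies of its `1/k`-stretch. -/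
theorem line {μ : V} (hμ : μ ∈ weightLattice R) : UnitSteps R i (line μ) := by
  obtain ⟨n, hn⟩ := hμ i
  have hn : (datum R i).φ μ = n := hn
  have key : ∀ k : ℕ, 0 < k → UnitSteps R i ((PathMap.line μ).stretch (k : ℝ≥0)⁻¹) →
      UnitSteps R i (PathMap.line μ) := by
    intro k hk hu
    have := hu.stretch k
    rwa [stretch_stretch, mul_inv_cancel₀ (Nat.cast_ne_zero.2 hk.ne'), stretch_one] at this
  rcases lt_trichotomy n 0 with h | h | h
  · obtain ⟨k, rfl⟩ := Int.exists_eq_neg_ofNat h.le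
    have hk : 0 < k := by omega
    exact key k hk (.neg μ hμ k hk (by rw [hn]; simp))
  · rw [← stretch_one (PathMap.line μ)]
    exact .zero μ hμ 1 (by rw [hn, h, Int.cast_zero])
  · obtain ⟨k, rfl⟩ := Int.eq_ofNat_of_zero_le h.le
    have hk : 0 < k := by omega
    exact key k hk (.pos μ hμ k hk (by rw [hn]; simp))

end UnitSteps

/-- Denominators are cleared along the generation of the path; integer stretches preserve the class,
so common multiples can be used. -/
theorem exists_stretch_unitSteps (i : ι) (hp : p ∈ BRat R) :
    ∃ n : ℕ, 0 < n ∧ UnitSteps R i (p.stretch n) := by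
  change Generated _ _ p at hp
  induction hp with
  | line μ hμ => exact ⟨1, one_pos, by simpa using UnitSteps.line hμ⟩
  | concat p q _ _ ihp ihq =>
    obtain ⟨n, hn, hp⟩ := ihp
    obtain ⟨m, hm, hq⟩ := ihq
    refine ⟨n * m, Nat.mul_pos hn hm, ?_⟩
    rw [stretch_concat]
    refine .concat _ _ ?_ ?_
    · have := hp.stretch m
      rwa [stretch_stretch, ← Nat.cast_mul, mul_comm] at this
    · have := hq.stretch n
      rwa [stretch_stretch, ← Nat.cast_mul] at this
  | reverse p _ ih =>
    obtain ⟨n, hn, hp⟩ := ih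
    exact ⟨n, hn, by rw [← reverse_stretch]; exact hp.reverse⟩
  | stretch r hr p _ ih =>
    obtain ⟨n, hn, hp⟩ := ih
    obtain ⟨a, rfl⟩ := hr
    refine ⟨n * a.den, Nat.mul_pos hn a.den_pos, ?_⟩
    have := hp.stretch a.num
    rw [stretch_stretch] at this ⊢
    convert this using 2
    have h1 : (a.den : ℝ≥0) * (a : ℝ≥0) = a.num := by
      exact_mod_cast NNRat.den_mul_eq_num a
    rw [Nat.cast_mul, mul_assoc, h1, mul_comm]

theorem f_eq_of_mem_bRat {e' f' : PathMap V → Option (PathMap V)}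
    (h : IsRootOperatorPair R i e f) (h' : IsRootOperatorPair R i e' f') (hp : p ∈ BRat R)
    (hpu : p ∈ BUniv R) : f p = f' p := by
  obtain ⟨n, hn, hu⟩ := exists_stretch_unitSteps i hp
  have hpow := (power_congr (B := {x | UnitSteps R i x}) (fun x hx => UnitSteps.f_eq h h' hx)
    (fun x hx => UnitSteps.f_mem h' hx) hu n).1
  rw [h.stretch_f p hpu n (.inl hn), h'.stretch_f p hpu n (.inl hn)] at hpow
  exact Option.map_injective (stretch_injective (Nat.cast_ne_zero.2 hn.ne')) hpow

/-! ### Uniqueness on all paths by approximation. -/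

theorem exists_seq_le_tendsto (r : ℝ≥0) :
    ∃ a : ℕ → ℚ≥0, (∀ n, (a n : ℝ≥0) ≤ r) ∧ Tendsto (fun n => (a n : ℝ≥0)) atTop (𝓝 r) := by
  have hr := r.coe_nonneg
  refine ⟨fun n => (⌊(r : ℝ) * n⌋₊ : ℚ≥0) / n, fun n => ?_, ?_⟩
  · rw [← NNReal.coe_le_coe]
    push_cast
    exact div_le_of_le_mul₀ n.cast_nonneg hr (Nat.floor_le (by positivity))
  · rw [← NNReal.tendsto_coe]
    push_cast
    exact (tendsto_nat_floor_mul_div_atTop hr).comp (tendsto_natCast_atTop_atTop (R := ℝ))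

theorem exists_seq_ge_tendsto (r : ℝ≥0) :
    ∃ a : ℕ → ℚ≥0, (∀ n, r ≤ (a n : ℝ≥0)) ∧ Tendsto (fun n => (a n : ℝ≥0)) atTop (𝓝 r) := by
  have hr := r.coe_nonneg
  -- The shift to `n + 1` avoids division by zero, whose value 0 would violate the lower bound.
  refine ⟨fun n => (⌈(r : ℝ) * (n + 1 : ℕ)⌉₊ : ℚ≥0) / (n + 1 : ℕ), fun n => ?_, ?_⟩
  · rw [← NNReal.coe_le_coe]
    push_cast
    rw [le_div_iff₀ (by positivity)]
    exact Nat.le_ceil _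
  · rw [← NNReal.tendsto_coe]
    have h := (tendsto_nat_ceil_mul_div_atTop hr).comp
      ((tendsto_natCast_atTop_atTop (R := ℝ)).comp (tendsto_add_atTop_nat 1))
    refine h.congr fun n => ?_
    simp

/-- The closed graph only speaks of sequences on which the operator is nonzero, so the approximants
must not lose rise. Rising segments are lengthened and falling ones shortened; the bound on falls is
carried along because a larger fall cancels rise in a concatenation. -/
theorem exists_seq_bRat (i : ι) (hp : p ∈ BUniv R) :
    ∃ q : ℕ → PathMap V, (∀ n, q n ∈ BRat R) ∧ Converges q p ∧
      ∀ n, rise (datum R i).φ p ≤ rise (datum R i).φ (q n) ∧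
        fall (datum R i).φ (q n) ≤ fall (datum R i).φ p := by
  have hs := ReflectionDatum.segmented (T := datum R i) hp
  clear hp
  induction hs with
  | seg r _ μ hμ =>
    have hmem : ∀ a : ℚ≥0, (line μ).stretch (a : ℝ≥0) ∈ BRat R := fun a =>
      Generated.stretch _ (Set.mem_range_self a) _ (.line μ hμ)
    rcases le_total 0 ((datum R i).φ μ) with h | h
    · obtain ⟨a, ha, hlim⟩ := exists_seq_ge_tendsto r
      refine ⟨fun n => (line μ).stretch (a n : ℝ≥0), fun n => hmem _,
        converges_stretch_line hlim μ, fun n => ?_⟩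
      simp only [rise_stretch_line, fall_stretch_line, max_eq_left (neg_nonpos.2 h),
        max_eq_right h, mul_zero, le_refl, and_true]
      exact mul_le_mul_of_nonneg_right (NNReal.coe_le_coe.2 (ha n)) h
    · obtain ⟨a, ha, hlim⟩ := exists_seq_le_tendsto r
      refine ⟨fun n => (line μ).stretch (a n : ℝ≥0), fun n => hmem _,
        converges_stretch_line hlim μ, fun n => ?_⟩
      simp only [rise_stretch_line, fall_stretch_line, max_eq_right (neg_nonneg.2 h),
        max_eq_left h, mul_zero, le_refl, true_and]
      exact mul_le_mul_of_nonneg_right (NNReal.coe_le_coe.2 (ha n)) (neg_nonneg.2 h)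
  | concat p q hp hq ihp ihq =>
    obtain ⟨x, hx, hxp, hx'⟩ := ihp
    obtain ⟨y, hy, hyq, hy'⟩ := ihq
    refine ⟨fun n => (x n).concat (y n), fun n => .concat _ _ (hx n) (hy n),
      hxp.concat hyq fun ψ => hq.isTame, fun n => ?_⟩
    have hxb := bdd i (bRat_subset (hx n))
    have hyb := bdd i (bRat_subset (hy n))
    have hpb : HeightBdd (datum R i).φ p := hp.isTame.heightBdd
    have hqb : HeightBdd (datum R i).φ q := hq.isTame.heightBdd
    rw [rise_concat hpb hqb, fall_concat hpb hqb, rise_concat hxb hyb, fall_concat hxb hyb]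
    obtain ⟨h1, h2⟩ := hx' n
    obtain ⟨h3, h4⟩ := hy' n
    exact ⟨add_le_add h3 (max_le_max_left _ (by linarith)),
      add_le_add h2 (max_le_max_left _ (by linarith))⟩

theorem f_eq_lowerOp_of_le (h : IsRootOperatorPair R i e f) (hf : HasClosedGraph (BUniv R) f)
    (hp : p ∈ BUniv R) (hr : 1 ≤ rise (datum R i).φ p) : f p = (datum R i).f p := by
  obtain ⟨q, hq, hqp, hle⟩ := exists_seq_bRat i hp
  have hqu := fun n => bRat_subset (hq n)
  have hfq : ∀ n, f (q n) = some (lower (datum R i).φ (datum R i).α 1 (q n)) := fun n => by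
    rw [f_eq_of_mem_bRat h (isRootOperatorPair i) (hq n) (hqu n), rootF_eq (hqu n)]
    exact lowerOp_of_le (hr.trans (hle n).1)
  rw [ReflectionDatum.f, lowerOp_of_le hr]
  exact hf q _ p _ hqu (fun n => h.mem_f _ (hqu n) _ (hfq n)) hp
    (ReflectionDatum.lower_mem (T := datum R i) hp zero_le_one) hfq hqp
    (hqp.lower (fun n => bdd i (hqu n)) (bdd i hp) 1)

theorem f_eq_rootF (h : IsRootOperatorPair R i e f) (hf : HasClosedGraph (BUniv R) f)
    (hp : p ∈ BUniv R) : f p = rootF R i p := by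
  rw [rootF_eq hp]
  rcases le_or_gt 1 (rise (datum R i).φ p) with hr | hr
  · exact f_eq_lowerOp_of_le h hf hp hr
  have hnone : (datum R i).f p = none := lowerOp_eq_none.2 hr
  rw [hnone]
  by_contra hne
  obtain ⟨x, hx⟩ := Option.ne_none_iff_exists'.1 hne
  have hxm := h.mem_f p hp x hx
  -- The weight drops by the root, whose height is 2, while `p` has rise below 1; this forces `x` to
  -- fall by more than 1.
  have hfall : 1 ≤ rise (datum R i).φ x.reverse := by
    have h1 := rise_sub_fall (φ := (datum R i).φ) x
    have h2 := rise_sub_fall (φ := (datum R i).φ) p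
    have hα : (datum R i).φ (R.root i) = 2 := (datum R i).apply_root
    rw [h.wt_f p hp x hx, map_sub, hα, ← h2] at h1
    rw [rise_reverse (bdd i hxm)]
    linarith [fall_nonneg (bdd i hp), rise_nonneg (bdd i hxm)]
  -- The axioms give `f x* = p*`, so the explicit lowering sends `x*` to `p*`. The explicit raising
  -- then returns `p*` to `x*`, although it is zero there because `p` has rise below 1.
  have h1 := f_eq_lowerOp_of_le h hf (reverse_mem hxm) hfall
  rw [h.reverse_f x hxm, h.e_f p hp x hx, Option.map_some] at h1
  have h2 := ReflectionDatum.e_f (T := datum R i) (reverse_mem hxm) h1.symm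
  have h3 := (raiseOp_reverse (φ := (datum R i).φ) (α := (datum R i).α) p).symm.trans h2
  rw [show lowerOp (datum R i).φ (datum R i).α p = none from hnone] at h3
  simp at h3

end RootPaths

end

theorem theorem5p8 {ι V N : Type*} [Finite ι] [AddCommGroup V] [Module ℝ V]
    [AddCommGroup N] [Module ℝ N] (R : RootPairing ι ℝ V N)
    [R.IsRootSystem] [R.IsCrystallographic] [R.IsReduced]
    (b : R.Base) (i : ι) (hi : i ∈ b.support) :
    -- the rank one operators are those of the pairing procedure
    ExtendPairing PathMap.dPlus PathMap.dMinus PathMap.rankOneE PathMap.rankOneF ∧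
    -- the root operators have the characteristic properties
    RootPaths.IsRootOperatorPair R i (RootPaths.rootE R i) (RootPaths.rootF R i) ∧
    RootPaths.TensorRule R i (RootPaths.rootE R i) (RootPaths.rootF R i) ∧
    PathMap.HasClosedGraph (RootPaths.BUniv R) (RootPaths.rootE R i) ∧
    PathMap.HasClosedGraph (RootPaths.BUniv R) (RootPaths.rootF R i) ∧
    -- uniqueness
    ∀ e f : PathMap V → Option (PathMap V), RootPaths.IsRootOperatorPair R i e f →
      (∀ p ∈ RootPaths.BRat R, e p = RootPaths.rootE R i p ∧ f p = RootPaths.rootF R i p) ∧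
      (PathMap.HasClosedGraph (RootPaths.BUniv R) e →
        PathMap.HasClosedGraph (RootPaths.BUniv R) f →
        ∀ p ∈ RootPaths.BUniv R,
          e p = RootPaths.rootE R i p ∧ f p = RootPaths.rootF R i p) := by
  refine ⟨SignWord.extendPairing, RootPaths.isRootOperatorPair i, RootPaths.tensorRule i,
    (PathMap.ReflectionDatum.hasClosedGraph_e (RootPaths.datum R i)).congr fun p hp =>
      RootPaths.rootE_eq hp,
    (PathMap.ReflectionDatum.hasClosedGraph_f (RootPaths.datum R i)).congr fun p hp =>
      RootPaths.rootF_eq hp, fun e f h => ⟨?_, fun _ hf => ?_⟩⟩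
  · exact RootPaths.eq_of_f_eq RootPaths.bRat_subset (fun p hp => .reverse p hp) h
      (RootPaths.isRootOperatorPair i) fun p hp =>
        RootPaths.f_eq_of_mem_bRat h (RootPaths.isRootOperatorPair i) hp (RootPaths.bRat_subset hp)
  · exact RootPaths.eq_of_f_eq subset_rfl (fun p hp => RootPaths.reverse_mem hp) h
      (RootPaths.isRootOperatorPair i) fun p hp => RootPaths.f_eq_rootF h hf hp
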